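/- **Definitions.** A *theory* $T$ is a category whose objects are the nonnegative integers, with distinguished morphisms $i_n : 1 \to n$ ($1\le i\le n$, $n \ge 0$) that make each $n$ the $n$-fold coproduct of $1$ with itself, and such that $1_1$ is the identity of $1$. Composition is written in diagrammatic order. A *grove theory* is a theory with a commutative monoid structure $(T(n,p),+,0_{n,p})$ on each hom-set such that $i_n\cdot(f+g)=i_n\cdot f+i_n\cdot g$, $i_n\cdot 0_{n,p}=0_{1,p}$, $(f+g)\cdot h=f\cdot h+g\cdot h$ and $0_{n,p}\cdot h=0_{n,q}$ for all $f,g:n\to p$ and $h:p\to q$. It is *idempotent* if $f+f=f$ for all $f$; each hom-set is then ordered by $f\le g \iff f+g=g$. An idempotent grove theory is *$\omega$-continuous* if every $\omega$-chain in a hom-set has a supremum and composition preserves suprema of $\omega$-chains in both arguments. A *morphism* of $\omega$-continuous idempotent grove theories is a functor that is the identity on objects and preserves the distinguished morphisms, $+$, the constants $0_{n,p}$, and the suprema of $\omega$-chains. Let $\Sigma=\biguplus_{n\ge 0}\Sigma_n$ be a ranked alphabet. A *synchronization tree* $1\to p$ over $\Sigma$ consists of countable sets of vertices and edges and a root; each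 edge has a source vertex, a finite sequence of target vertices, and a label, which is either a letter of $\Sigma_n$, where $n$ is the number of its targets, or one of the exit symbols $\mathsf{ex}_1,\dots,\mathsf{ex}_p$, in which case it has no targets; and each vertex is the target of a unique path from the root. The tree is *finite* if it has finitely many edges. A (finite) synchronization tree $n\to p$ is an $n$-tuple of (finite) synchronization trees $1\to p$. For trees $1\to p$, write $t\sqsubseteq t'$ if there is a *simulation* $t\to t'$, that is, a relation $R$ between the vertices of $t$ and those of $t'$ that relates the roots and is such that whenever $v\,R\,v'$ and $v\to(v_1,\dots,v_n)$ is an edge of $t$, there is an equally labelled edge $v'\to(v'_1,\dots,v'_n)$ of $t'$ with $v_j\,R\,v'_j$ for all $j$; for trees $n\to p$, $\sqsubseteq$ is defined componentwise. For $t:1\to p$ and $s=(s_1,\dots,s_p):p\to q$, the tree $t\cdot s$ arises from $t$ by replacing each edge labelled $\mathsf{ex}_i$ by a copy of $s_i$; the sum $t+t'$ arises from disjoint copies of $t$ and $t'$ by merging the roots; $0_{1,p}$ is the tree without edges; all this is extended componentwise to trees $n\to p$. A letter $\sigma\in\Sigma_n$ is identified with the tree $1\to n$ that has an edge $r\to(v_1,\dots,v_n)$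 labelled $\sigma$ from the root $r$ and an edge labelled $\mathsf{ex}_i$ from each $v_i$; and $\mathsf{ex}_i$ is identified with the tree $1\to n$ that has a single edge, labelled $\mathsf{ex}_i$. An *ideal* of finite synchronization trees $n\to p$ is a nonempty set of such trees that is downward closed with respect to $\sqsubseteq$; it is an *$\omega$-ideal* if it is generated by some $\omega$-chain $t_0\sqsubseteq t_1\sqsubseteq\cdots$. Let $\omega\mathbf{SFST}_\Sigma$ have as morphisms $n\to p$ the $\omega$-ideals of finite synchronization trees $n\to p$ over $\Sigma$, where $Q\cdot Q'$ is the ideal generated by all $f\cdot g$, and $Q+Q'$ is the ideal generated by all $f+g$, with $f\in Q$ and $g\in Q'$, and where the $i$th distinguished morphism $1\to n$, the identity of $n$ and the constant $0_{n,p}$ are the ideals generated by $\mathsf{ex}_i$, by $(\mathsf{ex}_1,\dots,\mathsf{ex}_n)$ and by the tree $0_{n,p}$, respectively. For $\sigma\in\Sigma_n$ let $\eta(\sigma):1\to n$ be the ideal generated by the tree $\sigma$. **Theorem.** For each ranked alphabet $\Sigma$, $\omega\mathbf{SFST}_\Sigma$ is the free $\omega$-continuous idempotent grove theory, freely generated by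 $\Sigma$. That is, $\omega\mathbf{SFST}_\Sigma$ is an $\omega$-continuous idempotent grove theory, $\eta$ is injective on each $\Sigma_n$, and for every $\omega$-continuous idempotent grove theory $T$ and every rank preserving function $\varphi$, mapping each $\sigma\in\Sigma_n$ to a morphism $\varphi(\sigma):1\to n$ of $T$, there is a unique morphism of $\omega$-continuous idempotent grove theories $\varphi^\sharp:\omega\mathbf{SFST}_\Sigma\to T$ with $\varphi^\sharp(\eta(\sigma))=\varphi(\sigma)$ for all $\sigma\in\Sigma$. -/

import Mathlib

universe u v

namespace Grove

/-! ### Idempotent grove theories -/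

/-- The operations of a theory with an additive structure: for each pair `n, p` of nonnegative
integers a set `Hom n p` of morphisms `n → p`, identities, composition in diagrammatic order, the
distinguished morphisms `inj n i : 1 → n` (with `i` in the `n`-element set `Fin n`), and a sum and
a constant on each hom-set. The laws are imposed below. -/
structure TheoryData where
  Hom : ℕ → ℕ → Type v
  id : (n : ℕ) → Hom n n
  comp : {n p q : ℕ} → Hom n p → Hom p q → Hom n q
  inj : (n : ℕ) → Fin n → Hom 1 n
  add : {n p : ℕ} → Hom n p → Hom n p → Hom n p
  zero : (n p : ℕ) → Hom n p

namespace TheoryData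

/-- A (Lawvere) theory: a category on the nonnegative integers in which each `n` is the `n`-fold
coproduct of `1` with itself, with the distinguished morphisms as coproduct injections, and in
which the distinguished morphism `1 → 1` is the identity. -/
structure IsTheory (T : TheoryData.{v}) : Prop where
  assoc : ∀ {m n p q : ℕ} (f : T.Hom m n) (g : T.Hom n p) (h : T.Hom p q),
    T.comp (T.comp f g) h = T.comp f (T.comp g h)
  id_comp : ∀ {n p : ℕ} (f : T.Hom n p), T.comp (T.id n) f = f
  comp_id : ∀ {n p : ℕ} (f : T.Hom n p), T.comp f (T.id p) = f
  tupling : ∀ {n p : ℕ} (f : Fin n → T.Hom 1 p), ∃! g : T.Hom n p, ∀ i, T.comp (T.inj n i) g = f i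
  inj_one : T.inj 1 0 = T.id 1

/-- A grove theory: a theory with a commutative monoid structure on each hom-set, compatible with
the distinguished morphisms and with composition in its first argument. -/
structure IsGroveTheory (T : TheoryData.{v}) : Prop extends T.IsTheory where
  add_assoc : ∀ {n p : ℕ} (f g h : T.Hom n p), T.add (T.add f g) h = T.add f (T.add g h)
  add_comm : ∀ {n p : ℕ} (f g : T.Hom n p), T.add f g = T.add g f
  add_zero : ∀ {n p : ℕ} (f : T.Hom n p), T.add f (T.zero n p) = f
  inj_add : ∀ {n p : ℕ} (i : Fin n) (f g : T.Hom n p),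
    T.comp (T.inj n i) (T.add f g) = T.add (T.comp (T.inj n i) f) (T.comp (T.inj n i) g)
  inj_zero : ∀ {n : ℕ} (p : ℕ) (i : Fin n), T.comp (T.inj n i) (T.zero n p) = T.zero 1 p
  add_comp : ∀ {n p q : ℕ} (f g : T.Hom n p) (h : T.Hom p q),
    T.comp (T.add f g) h = T.add (T.comp f h) (T.comp g h)
  zero_comp : ∀ {p q : ℕ} (n : ℕ) (h : T.Hom p q), T.comp (T.zero n p) h = T.zero n q

/-- A grove theory with an idempotent sum. -/
structure IsIdempotentGroveTheory (T : TheoryData.{v}) : Prop extends T.IsGroveTheory where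
  add_self : ∀ {n p : ℕ} (f : T.Hom n p), T.add f f = f

/-- The order `f ≤ g ↔ f + g = g` on a hom-set. -/
def Le (T : TheoryData.{v}) {n p : ℕ} (f g : T.Hom n p) : Prop :=
  T.add f g = g

/-- The sequence `f` is an `ω`-chain. -/
def IsChain (T : TheoryData.{v}) {n p : ℕ} (f : ℕ → T.Hom n p) : Prop :=
  ∀ k, T.Le (f k) (f (k + 1))

/-- `s` is the supremum (least upper bound) of the sequence `f`. -/
def IsSup (T : TheoryData.{v}) {n p : ℕ} (f : ℕ → T.Hom n p) (s : T.Hom n p) : Prop :=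
  (∀ k, T.Le (f k) s) ∧ ∀ b : T.Hom n p, (∀ k, T.Le (f k) b) → T.Le s b

/-- An `ω`-continuous idempotent grove theory: suprema of `ω`-chains exist in each hom-set, and
composition preserves them in both arguments. -/
structure IsOmegaContinuousIdempotentGroveTheory (T : TheoryData.{v}) : Prop
    extends T.IsIdempotentGroveTheory where
  exists_sup : ∀ {n p : ℕ} (f : ℕ → T.Hom n p), T.IsChain f → ∃ s, T.IsSup f s
  sup_comp : ∀ {n p q : ℕ} (f : ℕ → T.Hom n p) (s : T.Hom n p) (g : T.Hom p q),
    T.IsChain f → T.IsSup f s → T.IsSup (fun k => T.comp (f k) g) (T.comp s g)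
  comp_sup : ∀ {n p q : ℕ} (g : T.Hom n p) (f : ℕ → T.Hom p q) (s : T.Hom p q),
    T.IsChain f → T.IsSup f s → T.IsSup (fun k => T.comp g (f k)) (T.comp g s)

/-- A morphism of `ω`-continuous idempotent grove theories: a functor that is the identity on
objects and preserves the distinguished morphisms, the sum, the constants `0`, and the suprema of
`ω`-chains. -/
@[ext]
structure OmegaMorphism (T : TheoryData.{u}) (T' : TheoryData.{v}) where
  map : {n p : ℕ} → T.Hom n p → T'.Hom n p
  map_id : ∀ n : ℕ, map (T.id n) = T'.id n
  map_comp : ∀ {n p q : ℕ} (f : T.Hom n p) (g : T.Hom p q),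
    map (T.comp f g) = T'.comp (map f) (map g)
  map_inj : ∀ (n : ℕ) (i : Fin n), map (T.inj n i) = T'.inj n i
  map_add : ∀ {n p : ℕ} (f g : T.Hom n p), map (T.add f g) = T'.add (map f) (map g)
  map_zero : ∀ n p : ℕ, map (T.zero n p) = T'.zero n p
  map_sup : ∀ {n p : ℕ} (f : ℕ → T.Hom n p) (s : T.Hom n p),
    T.IsChain f → T.IsSup f s → T'.IsSup (fun k => map (f k)) (map s)

end TheoryData

/-! ### Synchronization trees

A ranked alphabet is a family `S : ℕ → Type u`, where `S n` is the set of letters of rank `n`. -/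

/-- A rooted hyper graph whose edges are labelled by letters of `S` or by exit symbols
`ex_i`, `i : Fin p`. The labelling is given by its fibres: `E n σ` is the set of edges labelled by
the letter `σ` of rank `n`, each with a source and a sequence of `n` targets; `X i` is the set of
edges labelled by the exit symbol `ex_i`, each with a source and no targets. -/
structure HyperGraph (S : ℕ → Type u) (p : ℕ) where
  V : Type
  root : V
  E : (n : ℕ) → S n → Type
  src : {n : ℕ} → {σ : S n} → E n σ → V
  tgt : {n : ℕ} → {σ : S n} → E n σ → Fin n → V
  X : Fin p → Type
  exitSrc : {i : Fin p} → X i → V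

namespace HyperGraph

variable {S : ℕ → Type u} {p : ℕ}

/-- The set of all edges. -/
def Edge (G : HyperGraph S p) : Type u :=
  (Σ n : ℕ, Σ σ : S n, G.E n σ) ⊕ (Σ i : Fin p, G.X i)

/-- The paths from the root to a vertex. -/
inductive Path (G : HyperGraph S p) : G.V → Type u
  | nil : Path G G.root
  | cons {n : ℕ} {σ : S n} (e : G.E n σ) (i : Fin n) : Path G (G.src e) → Path G (G.tgt e i)

/-- `R` is a simulation from `G` to `H`. -/
structure IsSimulation (G H : HyperGraph S p) (R : G.V → H.V → Prop) : Prop where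
  root : R G.root H.root
  edge : ∀ {n : ℕ} {σ : S n} (e : G.E n σ) (w : H.V), R (G.src e) w →
    ∃ d : H.E n σ, H.src d = w ∧ ∀ i, R (G.tgt e i) (H.tgt d i)
  exit : ∀ {i : Fin p} (e : G.X i) (w : H.V), R (G.exitSrc e) w → ∃ d : H.X i, H.exitSrc d = w

/-- The last step of a path. -/
def Path.last {G : HyperGraph S p} : {v : G.V} → G.Path v →
    Option (Σ n : ℕ, Σ σ : S n, G.E n σ × Fin n)
  | _, .nil => none
  | _, .cons (n := n) (σ := σ) e i _ => some ⟨n, σ, e, i⟩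

theorem existsUnique_path {G : HyperGraph S p} (hr : ∀ v, Nonempty (G.Path v))
    (h0 : ∀ {n : ℕ} {σ : S n} (e : G.E n σ) (i : Fin n), G.tgt e i ≠ G.root)
    (h1 : ∀ {n : ℕ} {σ : S n} (e : G.E n σ) (i : Fin n) {m : ℕ} {τ : S m} (d : G.E m τ)
      (j : Fin m), G.tgt e i = G.tgt d j →
      (⟨n, σ, e, i⟩ : Σ n : ℕ, Σ σ : S n, G.E n σ × Fin n) = ⟨m, τ, d, j⟩)
    (v : G.V) : ∃ w : G.Path v, ∀ w' : G.Path v, w' = w := by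
  have key : ∀ (a : G.V) (w : G.Path a) (b : G.V) (w' : G.Path b), a = b → HEq w' w := by
    intro a w
    induction w with
    | nil =>
      intro b w' h
      cases w' with
      | nil => rfl
      | cons e i w' => exact absurd h.symm (h0 e i)
    | cons e i w ih =>
      intro b w' h
      cases w' with
      | nil => exact absurd h (h0 e i)
      | cons d j w' =>
        have := h1 e i d j h
        cases this
        cases eq_of_heq (ih _ w' rfl)
        rfl
  obtain ⟨w⟩ := hr v
  exact ⟨w, fun w' => eq_of_heq (key v w v w' rfl)⟩

end HyperGraph

/-- A synchronization tree `1 → p` over `S`: a countable hyper graph in which each vertex is the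
target of a unique path from the root. -/
structure SyncTree (S : ℕ → Type u) (p : ℕ) extends HyperGraph S p where
  countable_V : Countable V
  countable_Edge : Countable toHyperGraph.Edge
  path : ∀ v, ∃ w : toHyperGraph.Path v, ∀ w' : toHyperGraph.Path v, w' = w

namespace SyncTree

variable {S : ℕ → Type u} {p q : ℕ}

theorem last_eq (t : SyncTree S p) {v v' : t.V} (h : v = v') (w : t.toHyperGraph.Path v)
    (w' : t.toHyperGraph.Path v') : w.last = w'.last := by
  subst h
  obtain ⟨x, hx⟩ := t.path v
  rw [hx w, hx w']

theorem tgt_ne_root (t : SyncTree S p) {n : ℕ} {σ : S n} (e : t.E n σ) (i : Fin n) :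
    t.tgt e i ≠ t.root := by
  intro h
  obtain ⟨w, -⟩ := t.path (t.src e)
  have := t.last_eq h (.cons e i w) .nil
  simp [HyperGraph.Path.last] at this

theorem tgt_injective (t : SyncTree S p) {n : ℕ} {σ : S n} (e : t.E n σ) (i : Fin n) {m : ℕ}
    {τ : S m} (d : t.E m τ) (j : Fin m) (h : t.tgt e i = t.tgt d j) :
    (⟨n, σ, e, i⟩ : Σ n : ℕ, Σ σ : S n, t.E n σ × Fin n) = ⟨m, τ, d, j⟩ := by
  obtain ⟨w, -⟩ := t.path (t.src e)
  obtain ⟨w', -⟩ := t.path (t.src d)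
  exact Option.some.inj (t.last_eq h (.cons e i w) (.cons d j w'))

/-- `t ⊑ t'`: there is a simulation `t → t'`. -/
def Le (t t' : SyncTree S p) : Prop :=
  ∃ R : t.V → t'.V → Prop, t.toHyperGraph.IsSimulation t'.toHyperGraph R

theorem Le.refl (t : SyncTree S p) : t.Le t :=
  ⟨Eq, rfl, fun e _ h => ⟨e, h, fun _ => rfl⟩, fun e _ h => ⟨e, h⟩⟩

theorem Le.trans {t t' t'' : SyncTree S p} (h : t.Le t') (h' : t'.Le t'') : t.Le t'' := by
  obtain ⟨R, hR⟩ := h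
  obtain ⟨Q, hQ⟩ := h'
  refine ⟨fun a c => ∃ b, R a b ∧ Q b c, ⟨_, hR.root, hQ.root⟩, ?_, ?_⟩
  · rintro n σ e c ⟨b, hab, hbc⟩
    obtain ⟨d, rfl, hd⟩ := hR.edge e b hab
    obtain ⟨d', rfl, hd'⟩ := hQ.edge d c hbc
    exact ⟨d', rfl, fun i => ⟨_, hd i, hd' i⟩⟩
  · rintro i e c ⟨b, hab, hbc⟩
    obtain ⟨d, rfl⟩ := hR.exit e b hab
    exact hQ.exit d c hbc

/-- A synchronization tree is finite if its set of edges is finite. -/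
def IsFinite (t : SyncTree S p) : Prop :=
  Finite t.toHyperGraph.Edge

/-- The hyper graph with a single vertex and no edges. -/
def zeroGraph (S : ℕ → Type u) (p : ℕ) : HyperGraph S p where
  V := Unit
  root := ()
  E _ _ := Empty
  src _ := ()
  tgt _ _ := ()
  X _ := Empty
  exitSrc _ := ()

theorem zeroGraph_finite (S : ℕ → Type u) (p : ℕ) : Finite (zeroGraph S p).Edge :=
  have : IsEmpty (Σ n : ℕ, Σ _ : S n, Empty) := ⟨fun x => x.2.2.elim⟩
  inferInstanceAs (Finite ((Σ n : ℕ, Σ _ : S n, Empty) ⊕ (Σ _ : Fin p, Empty)))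

/-- The tree `0` without edges. -/
def zero (S : ℕ → Type u) (p : ℕ) : SyncTree S p where
  toHyperGraph := zeroGraph S p
  countable_V := inferInstanceAs (Countable Unit)
  countable_Edge := @Finite.to_countable _ (zeroGraph_finite S p)
  path := HyperGraph.existsUnique_path (G := zeroGraph S p) (fun _ => ⟨.nil⟩)
    (fun e => Empty.elim e) (fun e => Empty.elim e)

theorem zero_isFinite (S : ℕ → Type u) (p : ℕ) : (zero S p).IsFinite :=
  zeroGraph_finite S p

/-- The hyper graph with a single vertex and a single edge, labelled by `ex_i`. -/
def exGraph (S : ℕ → Type u) (i : Fin p) : HyperGraph S p where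
  V := Unit
  root := ()
  E _ _ := Empty
  src _ := ()
  tgt _ _ := ()
  X j := PLift (j = i)
  exitSrc _ := ()

theorem exGraph_finite (S : ℕ → Type u) (i : Fin p) : Finite (exGraph S i).Edge :=
  have : IsEmpty (Σ n : ℕ, Σ _ : S n, Empty) := ⟨fun x => x.2.2.elim⟩
  inferInstanceAs (Finite ((Σ n : ℕ, Σ _ : S n, Empty) ⊕ (Σ j : Fin p, PLift (j = i))))

/-- The tree with a single edge, labelled by the exit symbol `ex_i`. -/
def ex (S : ℕ → Type u) (i : Fin p) : SyncTree S p where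
  toHyperGraph := exGraph S i
  countable_V := inferInstanceAs (Countable Unit)
  countable_Edge := @Finite.to_countable _ (exGraph_finite S i)
  path := HyperGraph.existsUnique_path (G := exGraph S i) (fun _ => ⟨.nil⟩)
    (fun e => Empty.elim e) (fun e => Empty.elim e)

theorem ex_isFinite (S : ℕ → Type u) (i : Fin p) : (ex S i).IsFinite :=
  exGraph_finite S i

/-- The edges of the tree of the letter `σ`: exactly one, labelled `σ`. -/
inductive LetterEdge {S : ℕ → Type u} {n : ℕ} (σ : S n) : (m : ℕ) → S m → Type
  | edge : LetterEdge σ n σ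

/-- The target sequence `(v_1, …, v_n)` of the edge labelled `σ`. -/
def LetterEdge.tgt {S : ℕ → Type u} {n : ℕ} {σ : S n} :
    {m : ℕ} → {τ : S m} → LetterEdge σ m τ → Fin m → Option (Fin n)
  | _, _, .edge, i => some i

theorem LetterEdge.eq {S : ℕ → Type u} {n : ℕ} {σ : S n} {m : ℕ} {τ : S m}
    (e : LetterEdge σ m τ) : (⟨n, σ, .edge⟩ : Σ m : ℕ, Σ τ : S m, LetterEdge σ m τ) = ⟨m, τ, e⟩ := by
  cases e; rfl

theorem letter_finite {S : ℕ → Type u} {n : ℕ} (σ : S n) :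
    Finite ((Σ m : ℕ, Σ τ : S m, LetterEdge σ m τ) ⊕ (Σ _ : Fin n, Unit)) := by
  have : Subsingleton (Σ m : ℕ, Σ τ : S m, LetterEdge σ m τ) :=
    ⟨fun ⟨_, _, e⟩ ⟨_, _, d⟩ => e.eq.symm.trans d.eq⟩
  infer_instance

/-- The hyper graph of the tree of a letter `σ` of rank `n`: an edge `r → (v_1, …, v_n)` labelled
`σ` from the root `r = none`, and an edge labelled `ex_i` from each `v_i = some i`. -/
def letterGraph {n : ℕ} (σ : S n) : HyperGraph S n where
  V := Option (Fin n)
  root := none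
  E m τ := LetterEdge σ m τ
  src _ := none
  tgt e i := e.tgt i
  X _ := Unit
  exitSrc {i} _ := some i

/-- The tree `1 → n` of a letter `σ` of rank `n`. -/
def letter {n : ℕ} (σ : S n) : SyncTree S n where
  toHyperGraph := letterGraph σ
  countable_V := inferInstanceAs (Countable (Option (Fin n)))
  countable_Edge := @Finite.to_countable _ (letter_finite σ)
  path := by
    refine HyperGraph.existsUnique_path (G := letterGraph σ) ?_ ?_ ?_
    · rintro (_ | i)
      · exact ⟨.nil⟩
      · exact ⟨.cons (G := letterGraph σ) LetterEdge.edge i .nil⟩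
    · rintro _ _ ⟨⟩ i h
      cases h
    · rintro _ _ ⟨⟩ i _ _ ⟨⟩ j h
      cases h
      rfl

theorem letter_isFinite {n : ℕ} (σ : S n) : (letter σ).IsFinite :=
  letter_finite σ

/-- The hyper graph underlying `dropExits`. -/
def dropExitsGraph (t : SyncTree S p) (q : ℕ) : HyperGraph S q where
  V := t.V
  root := t.root
  E := t.E
  src := t.src
  tgt := t.tgt
  X _ := Empty
  exitSrc e := e.elim

/-- The edges of `dropExits` are edges of `t`. -/
def dropExitsEdge (t : SyncTree S p) (q : ℕ) : (t.dropExitsGraph q).Edge → t.toHyperGraph.Edge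
  | .inl a => .inl a
  | .inr a => Empty.elim a.2

theorem dropExitsEdge_injective (t : SyncTree S p) (q : ℕ) :
    Function.Injective (t.dropExitsEdge q) := by
  rintro (a | ⟨_, ⟨⟩⟩) (b | ⟨_, ⟨⟩⟩) h
  exact congrArg Sum.inl (Sum.inl.inj h)

/-- The tree obtained from `t` by deleting all exit edges. -/
def dropExits (t : SyncTree S p) (q : ℕ) : SyncTree S q where
  toHyperGraph := t.dropExitsGraph q
  countable_V := t.countable_V
  countable_Edge := by
    have := t.countable_Edge
    exact (t.dropExitsEdge_injective q).countable
  path := by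
    refine HyperGraph.existsUnique_path (G := t.dropExitsGraph q) ?_ t.tgt_ne_root t.tgt_injective
    intro (v : t.V)
    obtain ⟨w, -⟩ := t.path v
    induction w with
    | nil => exact ⟨.nil⟩
    | cons e i _ ih =>
      obtain ⟨w'⟩ := ih
      exact ⟨.cons (G := t.dropExitsGraph q) e i w'⟩

theorem dropExits_isFinite {t : SyncTree S p} (ht : t.IsFinite) (q : ℕ) :
    (t.dropExits q).IsFinite := by
  have : Finite t.toHyperGraph.Edge := ht
  exact Finite.of_injective _ (t.dropExitsEdge_injective q)

section graft

variable (t : SyncTree S q) {ι : Type} (loc : ι → t.V) (s : ι → SyncTree S q)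

/-- The vertices of the tree obtained by attaching a copy of each `s k` at `loc k`, the root of
the copy being merged with `loc k`. -/
abbrev GraftV : Type :=
  t.V ⊕ (Σ k : ι, {v : (s k).V // v ≠ (s k).root})

open Classical in
/-- The inclusion of the `k`-th copy. -/
noncomputable def graftIn (k : ι) (v : (s k).V) : GraftV t s :=
  if h : v = (s k).root then .inl (loc k) else .inr ⟨k, v, h⟩

theorem graftIn_root (k : ι) : graftIn t loc s k (s k).root = .inl (loc k) :=
  dif_pos rfl

theorem graftIn_of_ne (k : ι) {v : (s k).V} (h : v ≠ (s k).root) :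
    graftIn t loc s k v = .inr ⟨k, v, h⟩ :=
  dif_neg h

/-- The hyper graph underlying `graft`. -/
noncomputable def graftGraph : HyperGraph S q where
  V := GraftV t s
  root := .inl t.root
  E n σ := t.E n σ ⊕ (Σ k : ι, (s k).E n σ)
  src e := match e with
    | .inl e => .inl (t.src e)
    | .inr ⟨k, e⟩ => graftIn t loc s k ((s k).src e)
  tgt e i := match e with
    | .inl e => .inl (t.tgt e i)
    | .inr ⟨k, e⟩ => graftIn t loc s k ((s k).tgt e i)
  X i := t.X i ⊕ (Σ k : ι, (s k).X i)
  exitSrc e := match e with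
    | .inl e => .inl (t.exitSrc e)
    | .inr ⟨k, e⟩ => graftIn t loc s k ((s k).exitSrc e)

/-- Each edge of the grafted tree comes from `t` or from one of the copies. -/
def graftEdge : (graftGraph t loc s).Edge →
    t.toHyperGraph.Edge ⊕ (Σ k : ι, (s k).toHyperGraph.Edge)
  | .inl ⟨n, σ, .inl e⟩ => .inl (.inl ⟨n, σ, e⟩)
  | .inl ⟨n, σ, .inr ⟨k, e⟩⟩ => .inr ⟨k, .inl ⟨n, σ, e⟩⟩
  | .inr ⟨i, .inl e⟩ => .inl (.inr ⟨i, e⟩)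
  | .inr ⟨i, .inr ⟨k, e⟩⟩ => .inr ⟨k, .inr ⟨i, e⟩⟩

theorem graftEdge_injective : Function.Injective (graftEdge t loc s) := by
  rintro (⟨n, σ, e | ⟨k, e⟩⟩ | ⟨i, e | ⟨k, e⟩⟩) (⟨n', σ', e' | ⟨k', e'⟩⟩ | ⟨i', e' | ⟨k', e'⟩⟩) h <;>
    simp only [graftEdge] at h <;> cases h <;> rfl

theorem graft_path (v : (graftGraph t loc s).V) :
    ∃ w : (graftGraph t loc s).Path v, ∀ w' : (graftGraph t loc s).Path v, w' = w := by
  have hl : ∀ v : t.V, Nonempty ((graftGraph t loc s).Path (.inl v)) := by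
    intro v
    obtain ⟨w, -⟩ := t.path v
    induction w with
    | nil => exact ⟨.nil⟩
    | cons e i _ ih =>
      obtain ⟨w'⟩ := ih
      exact ⟨.cons (G := graftGraph t loc s) (.inl e) i w'⟩
  have hin : ∀ (k : ι) (v : (s k).V),
      Nonempty ((graftGraph t loc s).Path (graftIn t loc s k v)) := by
    intro k v
    obtain ⟨w, -⟩ := (s k).path v
    induction w with
    | nil => rw [graftIn_root]; exact hl _
    | cons e i _ ih =>
      obtain ⟨w'⟩ := ih
      exact ⟨.cons (G := graftGraph t loc s) (.inr ⟨k, e⟩) i w'⟩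
  refine HyperGraph.existsUnique_path ?_ ?_ ?_ v
  · rintro (v | ⟨k, v, hv⟩)
    · exact hl v
    · have := hin k v
      rwa [graftIn_of_ne t loc s k hv] at this
  · rintro n σ (e | ⟨k, e⟩) i h
    · exact t.tgt_ne_root e i (Sum.inl.inj h)
    · have h' : graftIn t loc s k ((s k).tgt e i) = .inl t.root := h
      rw [graftIn_of_ne t loc s k ((s k).tgt_ne_root e i)] at h'
      cases h'
  · rintro n σ (e | ⟨k, e⟩) i m τ (d | ⟨l, d⟩) j h
    · cases t.tgt_injective e i d j (Sum.inl.inj h)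
      rfl
    · have h' : .inl (t.tgt e i) = graftIn t loc s l ((s l).tgt d j) := h
      rw [graftIn_of_ne t loc s l ((s l).tgt_ne_root d j)] at h'
      cases h'
    · have h' : graftIn t loc s k ((s k).tgt e i) = .inl (t.tgt d j) := h
      rw [graftIn_of_ne t loc s k ((s k).tgt_ne_root e i)] at h'
      cases h'
    · have h' : graftIn t loc s k ((s k).tgt e i) = graftIn t loc s l ((s l).tgt d j) := h
      rw [graftIn_of_ne t loc s k ((s k).tgt_ne_root e i),
        graftIn_of_ne t loc s l ((s l).tgt_ne_root d j)] at h'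
      have h2 := Sum.inr.inj h'
      obtain ⟨rfl, h3⟩ := Sigma.mk.inj h2
      have h4 := congrArg Subtype.val (eq_of_heq h3)
      cases (s k).tgt_injective e i d j h4
      rfl

/-- The tree obtained from `t` by attaching, for each `k : ι`, a copy of `s k` at the vertex
`loc k`: the root of the copy is merged with `loc k`, and the copies are otherwise disjoint from
each other and from `t`. -/
noncomputable def graft [Countable ι] : SyncTree S q where
  toHyperGraph := graftGraph t loc s
  countable_V := by
    have := t.countable_V
    have := fun k => (s k).countable_V
    change Countable (GraftV t s)
    infer_instance
  countable_Edge := by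
    have := t.countable_Edge
    have := fun k => (s k).countable_Edge
    exact (graftEdge_injective t loc s).countable
  path := graft_path t loc s

theorem graft_isFinite [Finite ι] (ht : t.IsFinite) (hs : ∀ k, (s k).IsFinite) :
    (t.graft loc s).IsFinite := by
  have : Finite t.toHyperGraph.Edge := ht
  have : ∀ k, Finite (s k).toHyperGraph.Edge := hs
  exact Finite.of_injective _ (graftEdge_injective t loc s)

variable {t loc s}

theorem graft_mono [Countable ι] {t' : SyncTree S q} {ι' : Type} [Countable ι'] {loc' : ι' → t'.V}
    {s' : ι' → SyncTree S q} {R : t.V → t'.V → Prop}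
    (hR : t.toHyperGraph.IsSimulation t'.toHyperGraph R)
    (h : ∀ k w, R (loc k) w → ∃ k', loc' k' = w ∧ (s k).Le (s' k')) :
    (t.graft loc s).Le (t'.graft loc' s') := by
  let Q : GraftV t s → GraftV t' s' → Prop := fun a b => match a with
    | .inl v => ∃ v', R v v' ∧ b = .inl v'
    | .inr ⟨k, v, _⟩ => ∃ k' v', b = graftIn t' loc' s' k' v' ∧
        ∃ P, (s k).toHyperGraph.IsSimulation (s' k').toHyperGraph P ∧ P v v'
  have hQ : ∀ k b (v : (s k).V), Q (graftIn t loc s k v) b → ∃ k' v',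
      b = graftIn t' loc' s' k' v' ∧
        ∃ P, (s k).toHyperGraph.IsSimulation (s' k').toHyperGraph P ∧ P v v' := by
    intro k b v hb
    by_cases hv : v = (s k).root
    · subst hv
      rw [graftIn_root] at hb
      obtain ⟨v', hv', rfl⟩ := hb
      obtain ⟨k', rfl, P, hP⟩ := h k v' hv'
      exact ⟨k', (s' k').root, (graftIn_root t' loc' s' k').symm, P, hP, hP.root⟩
    · rw [graftIn_of_ne t loc s k hv] at hb
      exact hb
  refine ⟨Q, ⟨_, hR.root, rfl⟩, ?_, ?_⟩
  · rintro n σ (e | ⟨k, e⟩) b hb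
    · obtain ⟨v', hv', rfl⟩ := hb
      obtain ⟨d, rfl, hd⟩ := hR.edge e v' hv'
      exact ⟨.inl d, rfl, fun i => ⟨_, hd i, rfl⟩⟩
    · obtain ⟨k', v', rfl, P, hP, hv⟩ := hQ k b _ hb
      obtain ⟨d, rfl, hd⟩ := hP.edge e v' hv
      refine ⟨.inr ⟨k', d⟩, rfl, fun i => ?_⟩
      change Q (graftIn t loc s k ((s k).tgt e i)) _
      rw [graftIn_of_ne t loc s k ((s k).tgt_ne_root e i)]
      exact ⟨k', _, rfl, P, hP, hd i⟩
  · rintro i (e | ⟨k, e⟩) b hb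
    · obtain ⟨v', hv', rfl⟩ := hb
      obtain ⟨d, rfl⟩ := hR.exit e v' hv'
      exact ⟨.inl d, rfl⟩
    · obtain ⟨k', v', rfl, P, hP, hv⟩ := hQ k b _ hb
      obtain ⟨d, rfl⟩ := hP.exit e v' hv
      exact ⟨.inr ⟨k', d⟩, rfl⟩

end graft

theorem countable_exits (t : SyncTree S p) : Countable (Σ i : Fin p, t.X i) := by
  have := t.countable_Edge
  exact Function.Injective.countable (β := t.toHyperGraph.Edge) Sum.inr_injective

theorem finite_exits {t : SyncTree S p} (ht : t.IsFinite) : Finite (Σ i : Fin p, t.X i) := by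
  have : Finite t.toHyperGraph.Edge := ht
  exact Finite.of_injective (β := t.toHyperGraph.Edge) _ Sum.inr_injective

/-- The composite `t · (s_1, …, s_p)`: each edge of `t` labelled `ex_i` is replaced by a copy of
`s_i`. -/
noncomputable def comp (t : SyncTree S p) (s : Fin p → SyncTree S q) : SyncTree S q :=
  have := t.countable_exits
  (t.dropExits q).graft (ι := Σ i : Fin p, t.X i) (fun e => t.exitSrc e.2) (fun e => s e.1)

theorem comp_isFinite {t : SyncTree S p} {s : Fin p → SyncTree S q} (ht : t.IsFinite)
    (hs : ∀ i, (s i).IsFinite) : (t.comp s).IsFinite :=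
  have := finite_exits ht
  graft_isFinite _ _ _ (dropExits_isFinite ht q) fun e => hs e.1

theorem comp_mono {t t' : SyncTree S p} {s s' : Fin p → SyncTree S q} (ht : t.Le t')
    (hs : ∀ i, (s i).Le (s' i)) : (t.comp s).Le (t'.comp s') := by
  obtain ⟨R, hR⟩ := ht
  have := t.countable_exits
  have := t'.countable_exits
  refine graft_mono (R := R) ⟨hR.root, hR.edge, fun e => Empty.elim e⟩ ?_
  rintro ⟨i, e⟩ w hw
  obtain ⟨d, hd⟩ := hR.exit e w hw
  exact ⟨⟨i, d⟩, hd, hs i⟩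

/-- The sum `t + s`: disjoint copies of `t` and `s` with their roots merged. -/
noncomputable def add (t s : SyncTree S p) : SyncTree S p :=
  (zero S p).graft (ι := Bool) (fun _ => (zero S p).root) (fun b => cond b t s)

theorem add_isFinite {t s : SyncTree S p} (ht : t.IsFinite) (hs : s.IsFinite) :
    (t.add s).IsFinite :=
  graft_isFinite _ _ _ (zero_isFinite S p) (by rintro (_ | _) <;> assumption)

theorem add_mono {t t' s s' : SyncTree S p} (ht : t.Le t') (hs : s.Le s') :
    (t.add s).Le (t'.add s') := by
  refine graft_mono (R := fun _ _ => True)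
    ⟨trivial, fun e => Empty.elim e, fun e => Empty.elim e⟩ ?_
  rintro (_ | _) w -
  · exact ⟨false, rfl, hs⟩
  · exact ⟨true, rfl, ht⟩

end SyncTree

/-! ### The theory of `ω`-ideals of finite synchronization trees -/

/-- The finite synchronization trees `n → p`: `n`-tuples of finite synchronization trees
`1 → p`. -/
def FST (S : ℕ → Type u) (n p : ℕ) : Type (max 1 u) :=
  Fin n → {t : SyncTree S p // t.IsFinite}

namespace FST

variable {S : ℕ → Type u} {n p q : ℕ}

/-- `f ⊑ g`: there is a simulation from each component of `f` to that of `g`. -/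
def Le (f g : FST S n p) : Prop :=
  ∀ i, (f i).1.Le (g i).1

theorem Le.refl (f : FST S n p) : f.Le f :=
  fun i => SyncTree.Le.refl (f i).1

theorem Le.trans {f g h : FST S n p} (hfg : f.Le g) (hgh : g.Le h) : f.Le h :=
  fun i => (hfg i).trans (hgh i)

/-- The identity `(ex_1, …, ex_n) : n → n`. -/
def id (S : ℕ → Type u) (n : ℕ) : FST S n n :=
  fun i => ⟨SyncTree.ex S i, SyncTree.ex_isFinite S i⟩

/-- The tree `ex_i : 1 → n`. -/
def ex (S : ℕ → Type u) (i : Fin n) : FST S 1 n :=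
  fun _ => ⟨SyncTree.ex S i, SyncTree.ex_isFinite S i⟩

/-- The tree `1 → n` of a letter of rank `n`. -/
def letter (σ : S n) : FST S 1 n :=
  fun _ => ⟨SyncTree.letter σ, SyncTree.letter_isFinite σ⟩

/-- The tree `0 : n → p`. -/
def zero (S : ℕ → Type u) (n p : ℕ) : FST S n p :=
  fun _ => ⟨SyncTree.zero S p, SyncTree.zero_isFinite S p⟩

/-- Componentwise composition. -/
noncomputable def comp (f : FST S n p) (g : FST S p q) : FST S n q :=
  fun i => ⟨(f i).1.comp fun j => (g j).1, SyncTree.comp_isFinite (f i).2 fun j => (g j).2⟩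

/-- Componentwise sum. -/
noncomputable def add (f g : FST S n p) : FST S n p :=
  fun i => ⟨(f i).1.add (g i).1, SyncTree.add_isFinite (f i).2 (g i).2⟩

theorem comp_mono {f f' : FST S n p} {g g' : FST S p q} (hf : f.Le f') (hg : g.Le g') :
    (f.comp g).Le (f'.comp g') :=
  fun i => SyncTree.comp_mono (hf i) hg

theorem add_mono {f f' g g' : FST S n p} (hf : f.Le f') (hg : g.Le g') :
    (f.add g).Le (f'.add g') :=
  fun i => SyncTree.add_mono (hf i) (hg i)

/-- An ideal: a nonempty set of finite trees `n → p` that is downward closed for `⊑`. -/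
def IsIdeal (Q : Set (FST S n p)) : Prop :=
  Q.Nonempty ∧ ∀ f g, f.Le g → g ∈ Q → f ∈ Q

/-- The downward closure of a set of trees, which is the ideal it generates if it is nonempty. -/
def generated (A : Set (FST S n p)) : Set (FST S n p) :=
  {f | ∃ g ∈ A, f.Le g}

/-- An `ω`-ideal: an ideal that is generated by some `ω`-chain. -/
def IsOmegaIdeal (Q : Set (FST S n p)) : Prop :=
  IsIdeal Q ∧ ∃ c : ℕ → FST S n p, (∀ k, (c k).Le (c (k + 1))) ∧ Q = generated (Set.range c)

theorem chain_le {c : ℕ → FST S n p} (hc : ∀ k, (c k).Le (c (k + 1))) {k l : ℕ} (h : k ≤ l) :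
    (c k).Le (c l) := by
  induction h with
  | refl => exact Le.refl _
  | step _ ih => exact ih.trans (hc _)

theorem isOmegaIdeal_generated {c : ℕ → FST S n p} (hc : ∀ k, (c k).Le (c (k + 1))) :
    IsOmegaIdeal (generated (Set.range c)) :=
  ⟨⟨⟨c 0, c 0, ⟨0, rfl⟩, Le.refl _⟩, fun _ _ hfg ⟨h, hh, hgh⟩ => ⟨h, hh, hfg.trans hgh⟩⟩, c, hc, rfl⟩

theorem isOmegaIdeal_principal (f : FST S n p) : IsOmegaIdeal (generated {f}) := by
  have := isOmegaIdeal_generated (c := fun _ => f) fun _ => Le.refl f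
  rwa [Set.range_const] at this

theorem isOmegaIdeal_generated_image2 {m l r : ℕ} {op : FST S n p → FST S m q → FST S l r}
    (hop : ∀ {f f' g g'}, f.Le f' → g.Le g' → (op f g).Le (op f' g'))
    {Q : Set (FST S n p)} {Q' : Set (FST S m q)} (hQ : IsOmegaIdeal Q) (hQ' : IsOmegaIdeal Q') :
    IsOmegaIdeal (generated (Set.image2 op Q Q')) := by
  obtain ⟨-, c, hc, rfl⟩ := hQ
  obtain ⟨-, d, hd, rfl⟩ := hQ'
  have h := isOmegaIdeal_generated (c := fun k => op (c k) (d k)) fun k => hop (hc k) (hd k)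
  convert h using 1
  ext x
  constructor
  · rintro ⟨_, ⟨f, ⟨_, ⟨k, rfl⟩, hf⟩, g, ⟨_, ⟨l, rfl⟩, hg⟩, rfl⟩, hx⟩
    exact ⟨_, ⟨max k l, rfl⟩, hx.trans (hop (hf.trans (chain_le hc (le_max_left k l)))
      (hg.trans (chain_le hd (le_max_right k l))))⟩
  · rintro ⟨_, ⟨k, rfl⟩, hx⟩
    exact ⟨_, ⟨c k, ⟨_, ⟨k, rfl⟩, Le.refl _⟩, d k, ⟨_, ⟨k, rfl⟩, Le.refl _⟩, rfl⟩, hx⟩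

end FST

/-- The `ω`-ideals of finite synchronization trees over `S`. The morphisms `n → p` are the
`ω`-ideals of finite trees `n → p`; the composite and the sum of `Q` and `Q'` are the ideals
generated by all `f · g` and by all `f + g`, respectively, with `f ∈ Q` and `g ∈ Q'`; identities,
distinguished morphisms and zeros are the principal ideals of those of finite trees. -/
noncomputable def omegaSFST (S : ℕ → Type u) : TheoryData.{max 1 u} where
  Hom n p := {Q : Set (FST S n p) // FST.IsOmegaIdeal Q}
  id n := ⟨FST.generated {FST.id S n}, FST.isOmegaIdeal_principal _⟩
  comp Q Q' := ⟨FST.generated (Set.image2 FST.comp Q.1 Q'.1),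
    FST.isOmegaIdeal_generated_image2 (op := FST.comp) FST.comp_mono Q.2 Q'.2⟩
  inj _ i := ⟨FST.generated {FST.ex S i}, FST.isOmegaIdeal_principal _⟩
  add Q Q' := ⟨FST.generated (Set.image2 FST.add Q.1 Q'.1),
    FST.isOmegaIdeal_generated_image2 (op := FST.add) FST.add_mono Q.2 Q'.2⟩
  zero n p := ⟨FST.generated {FST.zero S n p}, FST.isOmegaIdeal_principal _⟩

/-- The letter `σ` of rank `n` as a morphism `1 → n`: the principal ideal of its tree. -/
def letterIdeal {S : ℕ → Type u} {n : ℕ} (σ : S n) : (omegaSFST S).Hom 1 n :=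
  ⟨FST.generated {FST.letter σ}, FST.isOmegaIdeal_principal _⟩

end Grove

/-!
The order of the theory of `ω`-ideals is inclusion, and suprema of chains are unions; so the axioms
of an `ω`-continuous idempotent grove theory reduce, by computing with generating chains, to the
laws of composition and sum of finite trees up to mutual simulation. Two facts about grafting give
these laws: each attached copy is simulated by its image (`SyncTree.sim_graftIn`), and a simulation
of the base that is compatible with the attached copies extends to the grafted tree
(`SyncTree.graft_sim`). Simulations are considered between vertices of graphs (`HyperGraph.Sim`),
which avoids the construction of subtrees. The sum is a join for the simulation order.

For the universal property, let `φ` map the letters to an `ω`-continuous idempotent grove theory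
`T`. The value of a vertex of a finite tree in `T` is defined by recursion as the finite join of the
values of its outgoing edges (`IsEval`). It is monotone with respect to simulations
(`IsEval.mono`). Since every finite tree is equivalent to one built from `0` and the exit symbols by
sums and by prefixing letters (`SyncTree.finite_induction`), evaluation preserves composition
(`eval_comp`). The value of an `ω`-ideal is the least upper bound of the values of its
elements (`extend`), which exists because the ideal is generated by a chain; continuity of `T` makes
this a morphism. Conversely a morphism that extends `φ` is determined on the principal ideals of
finite trees by the same induction, hence on all tuples, and by continuity on all `ω`-ideals, each
of which is the supremum of a chain of principal ideals (`map_eq_extend`).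
-/

namespace Grove

/-! ### Simulations between pointed graphs -/

namespace HyperGraph

variable {S : ℕ → Type u} {p : ℕ}

/-- The vertex `w` of `H` simulates the vertex `v` of `G`: some relation between the vertices that
is compatible with the edges relates `v` to `w`. It replaces the comparison of the subtrees at `v`
and `w`, so that subtrees need not be constructed. -/
def Sim (G : HyperGraph S p) (v : G.V) (H : HyperGraph S p) (w : H.V) : Prop :=
  ∃ R : G.V → H.V → Prop, R v w ∧
    (∀ {n : ℕ} {σ : S n} (e : G.E n σ) (w : H.V), R (G.src e) w →
      ∃ d : H.E n σ, H.src d = w ∧ ∀ i, R (G.tgt e i) (H.tgt d i)) ∧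
    ∀ {i : Fin p} (e : G.X i) (w : H.V), R (G.exitSrc e) w → ∃ d : H.X i, H.exitSrc d = w

variable {G H K : HyperGraph S p}

theorem Sim.refl (v : G.V) : G.Sim v G v :=
  ⟨Eq, rfl, fun e _ h => ⟨e, h, fun _ => rfl⟩, fun e _ h => ⟨e, h⟩⟩

theorem Sim.edge {n : ℕ} {σ : S n} (e : G.E n σ) {w : H.V} (h : G.Sim (G.src e) H w) :
    ∃ d : H.E n σ, H.src d = w ∧ ∀ i, G.Sim (G.tgt e i) H (H.tgt d i) := by
  obtain ⟨R, h0, hE, hX⟩ := h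
  obtain ⟨d, hd, h⟩ := hE e w h0
  exact ⟨d, hd, fun i => ⟨R, h i, hE, hX⟩⟩

theorem Sim.exit {i : Fin p} (e : G.X i) {w : H.V} (h : G.Sim (G.exitSrc e) H w) :
    ∃ d : H.X i, H.exitSrc d = w := by
  obtain ⟨R, h0, hE, hX⟩ := h
  exact hX e w h0

theorem Sim.trans {a : G.V} {b : H.V} {c : K.V} (h : G.Sim a H b) (h' : H.Sim b K c) :
    G.Sim a K c := by
  refine ⟨fun a c => ∃ b, G.Sim a H b ∧ H.Sim b K c, ⟨b, h, h'⟩, ?_, ?_⟩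
  · rintro n σ e c ⟨b, hab, hbc⟩
    obtain ⟨d, rfl, hd⟩ := hab.edge e
    obtain ⟨d', rfl, hd'⟩ := hbc.edge d
    exact ⟨d', rfl, fun i => ⟨_, hd i, hd' i⟩⟩
  · rintro i e c ⟨b, hab, hbc⟩
    obtain ⟨d, rfl⟩ := hab.exit e
    exact hbc.exit d

/-- Similarity of pointed graphs is the greatest relation compatible with the edges: it suffices
to compare the edges at the two vertices. -/
theorem Sim.of_step {v : G.V} {w : H.V}
    (hE : ∀ {n : ℕ} {σ : S n} (e : G.E n σ), G.src e = v →
      ∃ d : H.E n σ, H.src d = w ∧ ∀ i, G.Sim (G.tgt e i) H (H.tgt d i))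
    (hX : ∀ {i : Fin p} (e : G.X i), G.exitSrc e = v → ∃ d : H.X i, H.exitSrc d = w) :
    G.Sim v H w := by
  refine ⟨fun a b => a = v ∧ b = w ∨ G.Sim a H b, .inl ⟨rfl, rfl⟩, ?_, ?_⟩
  · rintro n σ e b (⟨h, rfl⟩ | h)
    · obtain ⟨d, hd, h⟩ := hE e h
      exact ⟨d, hd, fun i => .inr (h i)⟩
    · obtain ⟨d, hd, h⟩ := h.edge e
      exact ⟨d, hd, fun i => .inr (h i)⟩
  · rintro i e b (⟨h, rfl⟩ | h)
    · exact hX e h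
    · exact h.exit e

end HyperGraph

namespace SyncTree

open HyperGraph

variable {S : ℕ → Type u} {p q r : ℕ}

theorem le_iff_sim {t t' : SyncTree S p} :
    t.Le t' ↔ t.toHyperGraph.Sim t.root t'.toHyperGraph t'.root :=
  ⟨fun ⟨R, h⟩ => ⟨R, h.root, h.edge, h.exit⟩, fun ⟨R, h0, hE, hX⟩ => ⟨R, h0, hE, hX⟩⟩

/-! ### Grafting and simulations -/

section graft

variable {t : SyncTree S q} {ι : Type} {loc : ι → t.V} {s : ι → SyncTree S q}

/-- Each copy is simulated by its image in the grafted tree, also at the root, where there may be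
further edges. -/
theorem sim_graftIn [Countable ι] (k : ι) (v : (s k).V) :
    (s k).toHyperGraph.Sim v (t.graft loc s).toHyperGraph (graftIn t loc s k v) :=
  ⟨fun v w => w = graftIn t loc s k v, rfl,
    fun e _ h => ⟨.inr ⟨k, e⟩, h.symm, fun _ => rfl⟩, fun e _ h => ⟨.inr ⟨k, e⟩, h.symm⟩⟩

theorem sim_loc [Countable ι] (k : ι) :
    (s k).toHyperGraph.Sim (s k).root (t.graft loc s).toHyperGraph (.inl (loc k)) := by
  rw [← graftIn_root]
  exact sim_graftIn k _

theorem graftIn_eq_inl {k : ι} {v : (s k).V} {a : t.V} (h : graftIn t loc s k v = .inl a) :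
    v = (s k).root ∧ loc k = a := by
  by_cases hv : v = (s k).root
  · subst hv
    rw [graftIn_root] at h
    exact ⟨rfl, Sum.inl.inj h⟩
  · rw [graftIn_of_ne t loc s k hv] at h
    cases h

/-- Away from the root, a vertex of a copy has no edges other than those of the copy. -/
theorem graftIn_sim [Countable ι] (k : ι) {v : (s k).V} (hv : v ≠ (s k).root) :
    (t.graft loc s).toHyperGraph.Sim (graftIn t loc s k v) (s k).toHyperGraph v := by
  have key : ∀ {k' : ι} {u : (s k').V} {w : (s k).V}, w ≠ (s k).root →
      graftIn t loc s k' u = graftIn t loc s k w → ∃ h : k' = k, h ▸ u = w := by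
    intro k' u w hw h
    rw [graftIn_of_ne t loc s k hw] at h
    by_cases hu : u = (s k').root
    · subst hu
      rw [graftIn_root] at h
      cases h
    · rw [graftIn_of_ne t loc s k' hu] at h
      obtain ⟨rfl, h3⟩ := Sigma.mk.inj (Sum.inr.inj h)
      exact ⟨rfl, congrArg Subtype.val (eq_of_heq h3)⟩
  refine ⟨fun a w => w ≠ (s k).root ∧ a = graftIn t loc s k w, ⟨hv, rfl⟩, ?_, ?_⟩
  · rintro n σ (e | ⟨k', e⟩) w ⟨hw, h⟩
    · rw [graftIn_of_ne t loc s k hw] at h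
      cases h
    · obtain ⟨rfl, rfl⟩ := key hw h
      exact ⟨e, rfl, fun i => ⟨(s _).tgt_ne_root e i, rfl⟩⟩
  · rintro i (e | ⟨k', e⟩) w ⟨hw, h⟩
    · rw [graftIn_of_ne t loc s k hw] at h
      cases h
    · obtain ⟨rfl, rfl⟩ := key hw h
      exact ⟨e, rfl⟩

/-- A simulation of `t` extends to the grafted tree if it is compatible with the attached
copies. -/
theorem graft_sim [Countable ι] {H : HyperGraph S q} (R : t.V → H.V → Prop) {v : t.V} {w : H.V}
    (h0 : R v w)
    (hE : ∀ {n : ℕ} {σ : S n} (e : t.E n σ) (w : H.V), R (t.src e) w →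
      ∃ d : H.E n σ, H.src d = w ∧ ∀ i, R (t.tgt e i) (H.tgt d i))
    (hX : ∀ {i : Fin q} (e : t.X i) (w : H.V), R (t.exitSrc e) w → ∃ d : H.X i, H.exitSrc d = w)
    (hs : ∀ k w, R (loc k) w → (s k).toHyperGraph.Sim (s k).root H w) :
    (t.graft loc s).toHyperGraph.Sim (.inl v) H w := by
  let Q : GraftV t s → H.V → Prop := fun a w => match a with
    | .inl v => R v w
    | .inr ⟨k, v, _⟩ => (s k).toHyperGraph.Sim v H w
  have hQ : ∀ k (v : (s k).V) w, Q (graftIn t loc s k v) w → (s k).toHyperGraph.Sim v H w := by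
    intro k v w h
    by_cases hv : v = (s k).root
    · subst hv
      rw [graftIn_root] at h
      exact hs k w h
    · rw [graftIn_of_ne t loc s k hv] at h
      exact h
  refine ⟨Q, h0, ?_, ?_⟩
  · rintro n σ (e | ⟨k, e⟩) w h
    · exact hE e w h
    · obtain ⟨d, hd, h⟩ := (hQ k _ w h).edge e
      refine ⟨d, hd, fun i => ?_⟩
      change Q (graftIn t loc s k ((s k).tgt e i)) _
      rw [graftIn_of_ne t loc s k ((s k).tgt_ne_root e i)]
      exact h i
  · rintro i (e | ⟨k, e⟩) w h
    · exact hX e w h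
    · exact (hQ k _ w h).exit e

end graft

/-- The inclusion of `t` in `t · s`. -/
def compIn (t : SyncTree S p) (s : Fin p → SyncTree S q) (v : t.V) : (t.comp s).V :=
  .inl v

/-- The edges of `t` that are labelled by letters, as edges of `t · s`. -/
def compEdge (t : SyncTree S p) (s : Fin p → SyncTree S q) {n : ℕ} {σ : S n} (e : t.E n σ) :
    (t.comp s).E n σ :=
  .inl e

/-- A simulation of the part of `t` labelled by letters extends to `t · s` if each vertex that
simulates the source of an exit edge `ex_i` simulates `s_i`. -/
theorem comp_sim {t : SyncTree S p} {s : Fin p → SyncTree S q} {H : HyperGraph S q}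
    (R : t.V → H.V → Prop) {v : t.V} {w : H.V} (h0 : R v w)
    (hE : ∀ {n : ℕ} {σ : S n} (e : t.E n σ) (w : H.V), R (t.src e) w →
      ∃ d : H.E n σ, H.src d = w ∧ ∀ i, R (t.tgt e i) (H.tgt d i))
    (hs : ∀ {i} (e : t.X i) w, R (t.exitSrc e) w → (s i).toHyperGraph.Sim (s i).root H w) :
    (t.comp s).toHyperGraph.Sim (t.compIn s v) H w :=
  have := t.countable_exits
  graft_sim (t := t.dropExits q) R h0 hE (fun e => Empty.elim e) fun k w h => hs k.2 w h

theorem sim_compIn (t : SyncTree S p) (s : Fin p → SyncTree S q) {i : Fin p} (e : t.X i) :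
    (s i).toHyperGraph.Sim (s i).root (t.comp s).toHyperGraph (t.compIn s (t.exitSrc e)) :=
  have := t.countable_exits
  sim_loc (t := t.dropExits q) (ι := Σ i : Fin p, t.X i) (loc := fun e => t.exitSrc e.2)
    (s := fun e => s e.1) ⟨i, e⟩

/-! ### The laws of the operations on trees, up to mutual simulation -/

/-- Mutual simulation. -/
def Equiv (t t' : SyncTree S p) : Prop :=
  t.Le t' ∧ t'.Le t

theorem zero_le (t : SyncTree S p) : (zero S p).Le t :=
  ⟨fun _ w => w = t.root, rfl, fun e => Empty.elim e, fun e => Empty.elim e⟩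

theorem ex_sim {G : HyperGraph S p} {i : Fin p} (e : G.X i) :
    (ex S i).toHyperGraph.Sim (ex S i).root G (G.exitSrc e) :=
  .of_step (fun e => Empty.elim e) fun {j} h _ => by
    obtain rfl : j = i := h.down
    exact ⟨e, rfl⟩

theorem exit_of_ex_sim {G : HyperGraph S p} {i : Fin p} {w : G.V}
    (h : (ex S i).toHyperGraph.Sim (ex S i).root G w) : ∃ e : G.X i, G.exitSrc e = w :=
  h.exit (G := (ex S i).toHyperGraph) (i := i) (PLift.up rfl)

theorem ex_comp (s : Fin p → SyncTree S q) (i : Fin p) : ((ex S i).comp s).Equiv (s i) := by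
  constructor
  · refine le_iff_sim.2 (comp_sim (fun _ w => w = (s i).root) rfl (fun e => Empty.elim e) ?_)
    rintro j ⟨rfl⟩ w rfl
    exact .refl _
  · exact le_iff_sim.2 (sim_compIn (ex S i) s (i := i) (PLift.up rfl))

theorem comp_ex (t : SyncTree S p) : (t.comp fun i => ex S i).Equiv t := by
  constructor
  · refine le_iff_sim.2 (comp_sim (fun v w => v = w) rfl (fun e w h => ⟨e, h, fun _ => rfl⟩) ?_)
    rintro i e w rfl
    exact ex_sim e
  · refine ⟨fun v w => w = t.compIn _ v, rfl,
      fun e w h => ⟨compEdge t _ e, h.symm, fun _ => rfl⟩, ?_⟩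
    rintro i e w rfl
    exact exit_of_ex_sim (sim_compIn t (fun i => ex S i) e)

theorem zero_comp (s : Fin p → SyncTree S q) : ((zero S p).comp s).Equiv (zero S q) :=
  ⟨le_iff_sim.2 (comp_sim (fun _ _ => True) trivial (fun e => Empty.elim e) fun e => Empty.elim e),
    zero_le _⟩

theorem comp_assoc (t : SyncTree S p) (s : Fin p → SyncTree S q) (z : Fin q → SyncTree S r) :
    ((t.comp s).comp z).Equiv (t.comp fun i => (s i).comp z) := by
  have := t.countable_exits
  let k0 : (Σ i : Fin p, t.X i) → (t.dropExits q).V := fun e => t.exitSrc e.2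
  let k1 : (Σ i : Fin p, t.X i) → (t.dropExits r).V := fun e => t.exitSrc e.2
  let s0 : (Σ i : Fin p, t.X i) → SyncTree S q := fun e => s e.1
  let s1 : (Σ i : Fin p, t.X i) → SyncTree S r := fun e => (s e.1).comp z
  constructor
  · -- The vertices of `t · s` are mapped to `t · (s · z)` in the evident way.
    let f : GraftV (t.dropExits q) s0 → GraftV (t.dropExits r) s1 := fun a => match a with
      | .inl v => .inl v
      | .inr ⟨k, v, _⟩ => graftIn _ k1 s1 k ((s k.1).compIn z v)
    have hf : ∀ k v, f (graftIn _ k0 s0 k v) = graftIn _ k1 s1 k ((s k.1).compIn z v) := by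
      intro k v
      by_cases hv : v = (s0 k).root
      · subst hv
        rw [graftIn_root]
        exact (graftIn_root _ k1 s1 k).symm
      · rw [graftIn_of_ne _ k0 s0 k hv]
    refine le_iff_sim.2 (comp_sim (t := t.comp s) (fun a b => b = f a) (v := .inl t.root) rfl ?_ ?_)
    · rintro n σ (e | ⟨k, e⟩) _ rfl
      · exact ⟨.inl e, rfl, fun i => rfl⟩
      · exact ⟨.inr ⟨k, compEdge _ z e⟩, (hf k _).symm, fun i => (hf k _).symm⟩
    · rintro i (e | ⟨k, e⟩) _ rfl
      · exact Empty.elim e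
      · have h1 := sim_compIn (s k.1) z e
        have h2 := sim_graftIn (t := t.dropExits r) (loc := k1) (s := s1) k
          ((s k.1).compIn z ((s k.1).exitSrc e))
        refine (h1.trans h2).trans ?_
        rw [← hf k]
        exact .refl _
  · -- A vertex of the copy of `s_i` at the exit edge `e` is sent to the same vertex of the copy
    -- of `s_i` inside `t · s`.
    refine le_iff_sim.2 (comp_sim (fun v w => w = (t.comp s).compIn z (t.compIn s v)) rfl
      (fun e w h => ⟨compEdge (t.comp s) z (compEdge t s e), h.symm, fun _ => rfl⟩) ?_)
    rintro i e _ rfl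
    refine comp_sim (t := s i) (v := (s i).root)
      (fun v w => w = (t.comp s).compIn z (graftIn _ k0 s0 ⟨i, e⟩ v)) ?_ ?_ ?_
    · exact congrArg Sum.inl (graftIn_root _ k0 s0 ⟨i, e⟩).symm
    · rintro n σ d _ rfl
      exact ⟨compEdge (t.comp s) z (.inr ⟨⟨i, e⟩, d⟩), rfl, fun _ => rfl⟩
    · rintro j d _ rfl
      exact sim_compIn (t.comp s) z (i := j) (.inr ⟨⟨i, e⟩, d⟩)

theorem le_add_left (t s : SyncTree S p) : t.Le (t.add s) :=
  le_iff_sim.2 (sim_loc (t := zero S p) (ι := Bool) (loc := fun _ => (zero S p).root)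
    (s := fun b => cond b t s) true)

theorem le_add_right (t s : SyncTree S p) : s.Le (t.add s) :=
  le_iff_sim.2 (sim_loc (t := zero S p) (ι := Bool) (loc := fun _ => (zero S p).root)
    (s := fun b => cond b t s) false)

theorem add_sim {t s : SyncTree S p} {H : HyperGraph S p} {w : H.V}
    (ht : t.toHyperGraph.Sim t.root H w) (hs : s.toHyperGraph.Sim s.root H w) :
    (t.add s).toHyperGraph.Sim (t.add s).root H w := by
  refine graft_sim (t := zero S p) (ι := Bool) (loc := fun _ => (zero S p).root)
    (s := fun b => cond b t s) (fun _ w' => w' = w) rfl (fun e => Empty.elim e)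
    (fun e => Empty.elim e) ?_
  rintro (_ | _) _ rfl
  · exact hs
  · exact ht

theorem add_le {t s z : SyncTree S p} (ht : t.Le z) (hs : s.Le z) : (t.add s).Le z :=
  le_iff_sim.2 (add_sim (le_iff_sim.1 ht) (le_iff_sim.1 hs))

theorem add_comp (t t' : SyncTree S p) (s : Fin p → SyncTree S q) :
    ((t.add t').comp s).Equiv ((t.comp s).add (t'.comp s)) := by
  constructor
  · let k0 : Bool → (zero S p).V := fun _ => ()
    let k1 : Bool → (zero S q).V := fun _ => ()
    let s0 : Bool → SyncTree S p := fun b => cond b t t'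
    let s1 : Bool → SyncTree S q := fun b => cond b (t.comp s) (t'.comp s)
    let g : ∀ b, (s0 b).V → (s1 b).V := fun b => match b with
      | true => t.compIn s
      | false => t'.compIn s
    -- The vertices of the copies of `t` and `t'` are mapped to those of `t · s` and `t' · s`.
    let f : GraftV (zero S p) s0 → GraftV (zero S q) s1 := fun a => match a with
      | .inl v => .inl v
      | .inr ⟨k, v, _⟩ => graftIn _ k1 s1 k (g k v)
    have hf : ∀ k v, f (graftIn _ k0 s0 k v) = graftIn _ k1 s1 k (g k v) := by
      intro k v
      by_cases hv : v = (s0 k).root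
      · subst hv
        rw [graftIn_root]
        have : g k (s0 k).root = (s1 k).root := by cases k <;> rfl
        rw [this]
        exact (graftIn_root _ k1 s1 k).symm
      · rw [graftIn_of_ne _ k0 s0 k hv]
    refine le_iff_sim.2 (comp_sim (t := t.add t') (fun a b => b = f a) (v := .inl ()) rfl ?_ ?_)
    · rintro n σ (e | ⟨k, e⟩) _ rfl
      · exact Empty.elim e
      · cases k
        · exact ⟨.inr ⟨false, compEdge t' s e⟩, (hf false (t'.src e)).symm,
            fun i => (hf false (t'.tgt e i)).symm⟩
        · exact ⟨.inr ⟨true, compEdge t s e⟩, (hf true (t.src e)).symm,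
            fun i => (hf true (t.tgt e i)).symm⟩
    · rintro i (e | ⟨k, e⟩) _ rfl
      · exact Empty.elim e
      · have h2 := sim_graftIn (t := zero S q) (loc := k1) (s := s1) k
          (g k ((s0 k).exitSrc e))
        rw [← hf k] at h2
        cases k
        · exact (sim_compIn t' s e).trans h2
        · exact (sim_compIn t s e).trans h2
  · exact add_le (comp_mono (le_add_left _ _) fun _ => .refl _)
      (comp_mono (le_add_right _ _) fun _ => .refl _)

/-! ### Prefixing a letter, and induction on finite trees -/

theorem letter_comp_sim {n : ℕ} {σ : S n} {s : Fin n → SyncTree S p} {H : HyperGraph S p}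
    (d : H.E n σ) (h : ∀ i, (s i).toHyperGraph.Sim (s i).root H (H.tgt d i)) :
    ((letter σ).comp s).toHyperGraph.Sim ((letter σ).comp s).root H (H.src d) := by
  refine comp_sim (t := letter σ) (fun a w => match a with
    | none => w = H.src d
    | some i => w = H.tgt d i) (v := none) rfl ?_ ?_
  · rintro _ _ ⟨⟩ w hw
    exact ⟨d, Eq.symm hw, fun i => rfl⟩
  · rintro i e w hw
    have hw : w = H.tgt d i := hw
    exact hw ▸ h i

theorem letter_le {n : ℕ} {σ τ : S n} (h : (letter σ).Le (letter τ)) : σ = τ := by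
  obtain ⟨d, -⟩ := (le_iff_sim.1 h).edge (G := (letter σ).toHyperGraph) LetterEdge.edge
  cases (d : LetterEdge τ n σ)
  rfl

theorem sim_letter_tgt {n : ℕ} (σ : S n) (s : Fin n → SyncTree S p) (i : Fin n) :
    (s i).toHyperGraph.Sim (s i).root ((letter σ).comp s).toHyperGraph
      ((letter σ).compIn s (some i)) :=
  sim_compIn (letter σ) s (i := i) ()

theorem letter_tgt_sim {n : ℕ} (σ : S n) (s : Fin n → SyncTree S p) (i : Fin n) :
    ((letter σ).comp s).toHyperGraph.Sim ((letter σ).compIn s (some i))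
      (s i).toHyperGraph (s i).root := by
  refine comp_sim (t := letter σ) (fun a w => a = some i ∧ w = (s i).root) ⟨rfl, rfl⟩ ?_ ?_
  · rintro _ _ ⟨⟩ w ⟨h, -⟩
    cases h
  · rintro j e w ⟨h, rfl⟩
    obtain rfl : j = i := Option.some.inj h
    exact .refl _

/-- The edges of `σ · s` at the root: there is just one. -/
theorem letter_comp_edge {n : ℕ} {σ : S n} {s : Fin n → SyncTree S p} {m : ℕ} {τ : S m}
    (e : ((letter σ).comp s).E m τ)
    (he : ((letter σ).comp s).src e = ((letter σ).comp s).root) :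
    (⟨n, σ, compEdge (letter σ) s .edge⟩ : Σ m : ℕ, Σ τ : S m, ((letter σ).comp s).E m τ) =
      ⟨m, τ, e⟩ := by
  obtain e | ⟨k, e⟩ := e
  · cases (e : LetterEdge σ m τ)
    rfl
  · have := (graftIn_eq_inl (t := (letter σ).dropExits p) (ι := Σ i : Fin n, (letter σ).X i)
      (loc := fun e => (letter σ).exitSrc e.2) (s := fun e => s e.1) he).2
    cases this

theorem letter_comp_exit {n : ℕ} {σ : S n} {s : Fin n → SyncTree S p} {i : Fin p}
    (e : ((letter σ).comp s).X i) : ((letter σ).comp s).exitSrc e ≠ ((letter σ).comp s).root := by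
  intro he
  obtain e | ⟨k, e⟩ := e
  · exact Empty.elim e
  · have := (graftIn_eq_inl (t := (letter σ).dropExits p) (ι := Σ i : Fin n, (letter σ).X i)
      (loc := fun e => (letter σ).exitSrc e.2) (s := fun e => s e.1) he).2
    cases this

theorem add_edge {t s : SyncTree S p} {n : ℕ} {σ : S n} (e : (t.add s).E n σ)
    (he : (t.add s).src e = (t.add s).root) :
    (∃ d : t.E n σ, t.src d = t.root ∧
      ∀ i, (t.add s).toHyperGraph.Sim ((t.add s).tgt e i) t.toHyperGraph (t.tgt d i)) ∨
    ∃ d : s.E n σ, s.src d = s.root ∧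
      ∀ i, (t.add s).toHyperGraph.Sim ((t.add s).tgt e i) s.toHyperGraph (s.tgt d i) := by
  obtain e | ⟨k, e⟩ := e
  · exact Empty.elim e
  · have h := (graftIn_eq_inl (t := zero S p) (ι := Bool) (loc := fun _ => (zero S p).root)
      (s := fun b => cond b t s) he).1
    have h' := fun i => graftIn_sim (t := zero S p) (ι := Bool)
      (loc := fun _ => (zero S p).root) (s := fun b => cond b t s) k (tgt_ne_root _ e i)
    cases k
    · exact .inr ⟨e, h, h'⟩
    · exact .inl ⟨e, h, h'⟩

theorem add_exit {t s : SyncTree S p} {i : Fin p} (e : (t.add s).X i)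
    (he : (t.add s).exitSrc e = (t.add s).root) :
    (∃ d : t.X i, t.exitSrc d = t.root) ∨ ∃ d : s.X i, s.exitSrc d = s.root := by
  obtain e | ⟨k, e⟩ := e
  · exact Empty.elim e
  · have h := (graftIn_eq_inl (t := zero S p) (ι := Bool) (loc := fun _ => (zero S p).root)
      (s := fun b => cond b t s) he).1
    cases k
    · exact .inr ⟨e, h⟩
    · exact .inl ⟨e, h⟩

/-- The relation between a vertex of a graph and its successors. -/
def Child (G : HyperGraph S p) (u v : G.V) : Prop :=
  ∃ (n : ℕ) (σ : S n) (e : G.E n σ) (i : Fin n), G.src e = v ∧ G.tgt e i = u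

/-- The number of edges of a path. -/
def pathLength {G : HyperGraph S p} : {v : G.V} → G.Path v → ℕ
  | _, .nil => 0
  | _, .cons _ _ w => pathLength w + 1

theorem finite_V {t : SyncTree S p} (ht : t.IsFinite) : Finite t.V := by
  have : Finite t.toHyperGraph.Edge := ht
  have : Finite (Σ n : ℕ, Σ σ : S n, t.E n σ) :=
    Finite.of_injective (β := t.toHyperGraph.Edge) _ Sum.inl_injective
  let f : Option (Σ a : (Σ n : ℕ, Σ σ : S n, t.E n σ), Fin a.1) → t.V := fun a => match a with
    | none => t.root
    | some ⟨⟨_, _, e⟩, i⟩ => t.tgt e i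
  refine Finite.of_surjective f fun v => ?_
  obtain ⟨w, -⟩ := t.path v
  cases w with
  | nil => exact ⟨none, rfl⟩
  | cons e i w => exact ⟨some ⟨⟨_, _, e⟩, i⟩, rfl⟩

/-- In a finite tree, passing to successors terminates: there are finitely many vertices, and the
length of the path from the root increases. -/
theorem wellFounded_child {t : SyncTree S p} (ht : t.IsFinite) :
    WellFounded (Child t.toHyperGraph) := by
  have := finite_V ht
  choose w hw using t.path
  let r : t.V → t.V → Prop := fun u v => pathLength (w v) < pathLength (w u)
  have : IsTrans t.V r := ⟨fun _ _ _ h h' => lt_trans h' h⟩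
  have : Std.Irrefl r := ⟨fun _ h => lt_irrefl _ h⟩
  refine Subrelation.wf (r := r) ?_ (Finite.wellFounded_of_trans_of_irrefl r)
  rintro _ _ ⟨n, σ, e, i, rfl, rfl⟩
  change _ < _
  rw [← hw _ (.cons e i (w _))]
  exact Nat.lt_succ_self _

/-- Up to mutual simulation, the finite trees are generated by the zero tree and the exit symbols
under sums and prefixing of letters. -/
theorem finite_induction {P : SyncTree S p → Prop}
    (hP : ∀ {t t' : SyncTree S p}, t.IsFinite → t'.IsFinite → t.Equiv t' → P t → P t')
    (h0 : P (zero S p)) (hex : ∀ i, P (ex S i))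
    (hadd : ∀ {t s : SyncTree S p}, t.IsFinite → s.IsFinite → P t → P s → P (t.add s))
    (hletter : ∀ {n : ℕ} (σ : S n) (s : Fin n → SyncTree S p), (∀ i, (s i).IsFinite) →
      (∀ i, P (s i)) → P ((letter σ).comp s))
    {t : SyncTree S p} (ht : t.IsFinite) : P t := by
  -- For each vertex `v` there is a generated tree that is equivalent to the subtree at `v`.
  have key : ∀ v : t.V, ∃ t' : SyncTree S p, t'.IsFinite ∧ P t' ∧
      t'.toHyperGraph.Sim t'.root t.toHyperGraph v ∧
      t.toHyperGraph.Sim v t'.toHyperGraph t'.root := by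
    intro v
    induction v using (wellFounded_child ht).induction with
    | _ v ih =>
    -- `C a z`: if the edge `a` has source `v`, then it is matched by an edge at the root of `z`.
    -- A tree that lies below the subtree at `v` and matches all edges is equivalent to it.
    let C : t.toHyperGraph.Edge → SyncTree S p → Prop := fun a z => match a with
      | .inl ⟨n, σ, e⟩ => t.src e = v → ∃ d : z.E n σ, z.src d = z.root ∧
          ∀ i, t.toHyperGraph.Sim (t.tgt e i) z.toHyperGraph (z.tgt d i)
      | .inr ⟨i, e⟩ => t.exitSrc e = v → ∃ d : z.X i, z.exitSrc d = z.root
    have hC : ∀ a {z z'}, z.Le z' → C a z → C a z' := by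
      rintro (⟨n, σ, e⟩ | ⟨i, e⟩) z z' hz h hv
      · obtain ⟨d, hd, h⟩ := h hv
        obtain ⟨d', hd', h'⟩ := Sim.edge d (hd ▸ le_iff_sim.1 hz)
        exact ⟨d', hd', fun i => (h i).trans (h' i)⟩
      · obtain ⟨d, hd⟩ := h hv
        exact Sim.exit d (hd ▸ le_iff_sim.1 hz)
    have hone : ∀ a, ∃ z : SyncTree S p, z.IsFinite ∧ P z ∧
        z.toHyperGraph.Sim z.root t.toHyperGraph v ∧ C a z := by
      rintro (⟨n, σ, e⟩ | ⟨i, e⟩)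
      · by_cases hv : t.src e = v
        · choose s hs1 hs2 hs3 hs4 using fun i => ih (t.tgt e i) ⟨n, σ, e, i, hv, rfl⟩
          exact ⟨(letter σ).comp s, comp_isFinite (letter_isFinite σ) hs1, hletter σ s hs1 hs2,
            hv ▸ letter_comp_sim e hs3, fun _ => ⟨compEdge (letter σ) s .edge, rfl,
              fun i => (hs4 i).trans (sim_letter_tgt σ s i)⟩⟩
        · exact ⟨zero S p, zero_isFinite S p, h0,
            .of_step (fun e => Empty.elim e) (fun e => Empty.elim e), fun h => absurd h hv⟩
      · by_cases hv : t.exitSrc e = v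
        · exact ⟨ex S i, ex_isFinite S i, hex i, hv ▸ ex_sim e, fun _ => ⟨PLift.up rfl, rfl⟩⟩
        · exact ⟨zero S p, zero_isFinite S p, h0,
            .of_step (fun e => Empty.elim e) (fun e => Empty.elim e), fun h => absurd h hv⟩
    have hall : ∀ B : Finset t.toHyperGraph.Edge, ∃ z : SyncTree S p, z.IsFinite ∧ P z ∧
        z.toHyperGraph.Sim z.root t.toHyperGraph v ∧ ∀ a ∈ B, C a z := by
      classical
      intro B
      induction B using Finset.induction_on with
      | empty => exact ⟨zero S p, zero_isFinite S p, h0,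
            .of_step (fun e => Empty.elim e) (fun e => Empty.elim e), by simp⟩
      | insert a B _ ihB =>
        obtain ⟨z, hz1, hz2, hz3, hz4⟩ := ihB
        obtain ⟨y, hy1, hy2, hy3, hy4⟩ := hone a
        refine ⟨y.add z, add_isFinite hy1 hz1, hadd hy1 hz1 hy2 hz2, add_sim hy3 hz3, ?_⟩
        intro b hb
        obtain rfl | hb := Finset.mem_insert.1 hb
        · exact hC _ (le_add_left _ _) hy4
        · exact hC _ (le_add_right _ _) (hz4 b hb)
    have : Finite t.toHyperGraph.Edge := ht
    have := Fintype.ofFinite t.toHyperGraph.Edge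
    obtain ⟨z, hz1, hz2, hz3, hz4⟩ := hall Finset.univ
    exact ⟨z, hz1, hz2, hz3, .of_step (fun e => hz4 (.inl ⟨_, _, e⟩) (Finset.mem_univ _))
      fun e => hz4 (.inr ⟨_, e⟩) (Finset.mem_univ _)⟩
  obtain ⟨t', h1, h2, h3, h4⟩ := key t.root
  exact hP h1 ht ⟨le_iff_sim.2 h3, le_iff_sim.2 h4⟩ h2

end SyncTree

/-! ### Order and tupling in an idempotent grove theory -/

namespace TheoryData

variable {T : TheoryData.{v}} {n p q : ℕ}

namespace IsIdempotentGroveTheory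

variable (hT : T.IsIdempotentGroveTheory)

include hT

theorem le_refl (f : T.Hom n p) : T.Le f f :=
  hT.add_self f

theorem le_trans {f g h : T.Hom n p} (h₁ : T.Le f g) (h₂ : T.Le g h) : T.Le f h := by
  unfold Le at *
  rw [← h₂, ← hT.add_assoc, h₁]

theorem le_antisymm {f g : T.Hom n p} (h₁ : T.Le f g) (h₂ : T.Le g f) : f = g := by
  unfold Le at *
  rw [← h₂, hT.add_comm, h₁]

theorem zero_le (f : T.Hom n p) : T.Le (T.zero n p) f := by
  unfold Le
  rw [hT.add_comm, hT.add_zero]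

theorem add_le_iff {f g h : T.Hom n p} : T.Le (T.add f g) h ↔ T.Le f h ∧ T.Le g h := by
  unfold Le
  constructor
  · intro H
    constructor
    · rw [← H, ← hT.add_assoc, ← hT.add_assoc, hT.add_self]
    · rw [← H, ← hT.add_assoc, hT.add_comm g, hT.add_assoc f, hT.add_self]
  · rintro ⟨h₁, h₂⟩
    rw [hT.add_assoc, h₂, h₁]

theorem le_add_left (f g : T.Hom n p) : T.Le f (T.add f g) :=
  (hT.add_le_iff.1 (hT.le_refl _)).1

theorem le_add_right (f g : T.Hom n p) : T.Le g (T.add f g) :=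
  (hT.add_le_iff.1 (hT.le_refl _)).2

/-- An element is determined by its upper bounds. -/
theorem eq_of_le_iff {f g : T.Hom n p} (h : ∀ b, T.Le f b ↔ T.Le g b) : f = g :=
  hT.le_antisymm ((h g).2 (hT.le_refl g)) ((h f).1 (hT.le_refl f))

theorem comp_mono_left {f f' : T.Hom n p} (h : T.Le f f') (g : T.Hom p q) :
    T.Le (T.comp f g) (T.comp f' g) := by
  unfold Le at *
  rw [← hT.add_comp, h]

theorem chain_le {f : ℕ → T.Hom n p} (hf : T.IsChain f) {k l : ℕ} (h : k ≤ l) :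
    T.Le (f k) (f l) := by
  induction h with
  | refl => exact hT.le_refl _
  | step _ ih => exact hT.le_trans ih (hf _)

theorem isSup_iff {f : ℕ → T.Hom n p} {s : T.Hom n p} :
    T.IsSup f s ↔ ∀ b, T.Le s b ↔ ∀ k, T.Le (f k) b :=
  ⟨fun h b => ⟨fun hb k => hT.le_trans (h.1 k) hb, h.2 b⟩,
    fun h => ⟨(h s).1 (hT.le_refl s), fun b => (h b).2⟩⟩

/-- Every finite family has a least upper bound. -/
theorem exists_bound {ι : Type*} [Finite ι] (f : ι → T.Hom n p) :
    ∃ s, ∀ b, T.Le s b ↔ ∀ k, T.Le (f k) b := by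
  have key : ∀ B : Finset ι, ∃ s, ∀ b, T.Le s b ↔ ∀ k ∈ B, T.Le (f k) b := by
    classical
    intro B
    induction B using Finset.induction_on with
    | empty => exact ⟨T.zero n p, fun b => by simp [hT.zero_le b]⟩
    | insert a B _ ih =>
      obtain ⟨s, hs⟩ := ih
      exact ⟨T.add (f a) s, fun b => by simp [hT.add_le_iff, hs]⟩
  have := Fintype.ofFinite ι
  simpa using key Finset.univ

end IsIdempotentGroveTheory

/-- The tuple `⟨f_1, …, f_n⟩ : n → p` of morphisms `f_i : 1 → p`. -/
noncomputable def tuple (hT : T.IsTheory) (f : Fin n → T.Hom 1 p) : T.Hom n p :=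
  (hT.tupling f).choose

theorem inj_tuple (hT : T.IsTheory) (f : Fin n → T.Hom 1 p) (i : Fin n) :
    T.comp (T.inj n i) (tuple hT f) = f i :=
  (hT.tupling f).choose_spec.1 i

theorem IsTheory.hom_ext (hT : T.IsTheory) {f g : T.Hom n p}
    (h : ∀ i, T.comp (T.inj n i) f = T.comp (T.inj n i) g) : f = g :=
  (hT.tupling fun i => T.comp (T.inj n i) g).unique h fun _ => rfl

theorem tuple_comp (hT : T.IsTheory) (f : Fin n → T.Hom 1 p) (g : T.Hom p q) :
    T.comp (tuple hT f) g = tuple hT fun i => T.comp (f i) g :=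
  hT.hom_ext fun i => by rw [← hT.assoc, inj_tuple, inj_tuple]

theorem tuple_inj (hT : T.IsTheory) : tuple hT (T.inj n) = T.id n :=
  hT.hom_ext fun i => by rw [inj_tuple, hT.comp_id]

/-- The order on `n → p` is componentwise. -/
theorem le_iff_forall (hT : T.IsIdempotentGroveTheory) {f g : T.Hom n p} :
    T.Le f g ↔ ∀ i, T.Le (T.comp (T.inj n i) f) (T.comp (T.inj n i) g) := by
  unfold Le
  constructor
  · intro h i
    rw [← hT.inj_add, h]
  · intro h
    refine hT.hom_ext fun i => ?_
    rw [hT.inj_add, h]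

theorem tuple_mono (hT : T.IsIdempotentGroveTheory) {f g : Fin n → T.Hom 1 p}
    (h : ∀ i, T.Le (f i) (g i)) : T.Le (tuple hT.toIsTheory f) (tuple hT.toIsTheory g) :=
  (le_iff_forall hT).2 fun i => by simpa only [inj_tuple] using h i

/-- Monotonicity of composition in its second argument follows from continuity, applied to the
chain `f, f', f', …`. -/
theorem comp_mono_right (hT : T.IsOmegaContinuousIdempotentGroveTheory) (g : T.Hom n p)
    {f f' : T.Hom p q} (h : T.Le f f') : T.Le (T.comp g f) (T.comp g f') := by
  have h1 : T.IsChain fun k => if k = 0 then f else f' := by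
    intro k
    cases k with
    | zero => simpa using h
    | succ k => simpa using hT.le_refl f'
  have h2 : T.IsSup (fun k => if k = 0 then f else f') f' := by
    refine ⟨fun k => ?_, fun b hb => by simpa using hb 1⟩
    dsimp only
    split_ifs
    exacts [h, hT.le_refl f']
  simpa using (hT.comp_sup g _ _ h1 h2).1 0

/-- Composition preserves suprema of chains in both arguments jointly. -/
theorem isSup_comp (hT : T.IsOmegaContinuousIdempotentGroveTheory) {f : ℕ → T.Hom n p}
    {g : ℕ → T.Hom p q} {s : T.Hom n p} {s' : T.Hom p q} (hf : T.IsChain f) (hg : T.IsChain g)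
    (hs : T.IsSup f s) (hs' : T.IsSup g s') :
    T.IsSup (fun k => T.comp (f k) (g k)) (T.comp s s') := by
  have hT' := hT.toIsIdempotentGroveTheory
  constructor
  · exact fun k => hT'.le_trans (hT'.comp_mono_left (hs.1 k) _) (comp_mono_right hT _ (hs'.1 k))
  · intro b hb
    refine (hT.sup_comp f s s' hf hs).2 b fun k => (hT.comp_sup (f k) g s' hg hs').2 b fun l => ?_
    exact hT'.le_trans (hT'.comp_mono_left (hT'.chain_le hf (le_max_left k l)) _)
      (hT'.le_trans (comp_mono_right hT _ (hT'.chain_le hg (le_max_right k l))) (hb (max k l)))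

end TheoryData

/-! ### The theory of `ω`-ideals -/

namespace FST

variable {S : ℕ → Type u} {n p q r : ℕ}

theorem le_add_left (f g : FST S n p) : f.Le (f.add g) :=
  fun i => SyncTree.le_add_left (f i).1 (g i).1

theorem le_add_right (f g : FST S n p) : g.Le (f.add g) :=
  fun i => SyncTree.le_add_right (f i).1 (g i).1

theorem add_le {f g h : FST S n p} (hf : f.Le h) (hg : g.Le h) : (f.add g).Le h :=
  fun i => SyncTree.add_le (hf i) (hg i)

theorem mem_generated_range {c : ℕ → FST S n p} {f : FST S n p} :
    f ∈ generated (Set.range c) ↔ ∃ k, f.Le (c k) := by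
  simp [generated]

theorem mem_principal {f g : FST S n p} : f ∈ generated {g} ↔ f.Le g := by
  simp [generated]

/-- The `ω`-ideal generated by an `ω`-chain. -/
def ofChain (c : ℕ → FST S n p) (hc : ∀ k, (c k).Le (c (k + 1))) : (omegaSFST S).Hom n p :=
  ⟨generated (Set.range c), isOmegaIdeal_generated hc⟩

/-- The principal ideal of a tree. -/
def principal (f : FST S n p) : (omegaSFST S).Hom n p :=
  ⟨generated {f}, isOmegaIdeal_principal f⟩

theorem exists_eq_ofChain (Q : (omegaSFST S).Hom n p) : ∃ c hc, Q = ofChain c hc := by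
  obtain ⟨Q, h, c, hc, rfl⟩ := Q
  exact ⟨c, hc, rfl⟩

theorem principal_eq_ofChain (f : FST S n p) :
    principal f = ofChain (fun _ => f) fun _ => Le.refl f :=
  Subtype.ext (by simp [principal, ofChain])

theorem mem_of_le {Q : (omegaSFST S).Hom n p} {f g : FST S n p} (h : f.Le g) (hg : g ∈ Q.1) :
    f ∈ Q.1 :=
  Q.2.1.2 f g h hg

theorem add_mem {Q : (omegaSFST S).Hom n p} {f g : FST S n p} (hf : f ∈ Q.1) (hg : g ∈ Q.1) :
    f.add g ∈ Q.1 := by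
  obtain ⟨c, hc, rfl⟩ := exists_eq_ofChain Q
  obtain ⟨k, hk⟩ := mem_generated_range.1 hf
  obtain ⟨l, hl⟩ := mem_generated_range.1 hg
  exact mem_generated_range.2 ⟨max k l, add_le (hk.trans (chain_le hc (le_max_left k l)))
    (hl.trans (chain_le hc (le_max_right k l)))⟩

theorem ofChain_ext {c d : ℕ → FST S n p} {hc hd} (h : ∀ k, (c k).Le (d k))
    (h' : ∀ k, (d k).Le (c k)) : ofChain c hc = ofChain d hd := by
  refine Subtype.ext (Set.ext fun f => ?_)
  change f ∈ generated _ ↔ f ∈ generated _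
  simp only [mem_generated_range]
  exact ⟨fun ⟨k, hk⟩ => ⟨k, hk.trans (h k)⟩, fun ⟨k, hk⟩ => ⟨k, hk.trans (h' k)⟩⟩

theorem generated_image2 {m l r : ℕ} {op : FST S n p → FST S m q → FST S l r}
    (hop : ∀ {f f' g g'}, f.Le f' → g.Le g' → (op f g).Le (op f' g'))
    {c : ℕ → FST S n p} {d : ℕ → FST S m q} (hc : ∀ k, (c k).Le (c (k + 1)))
    (hd : ∀ k, (d k).Le (d (k + 1))) :
    generated (Set.image2 op (generated (Set.range c)) (generated (Set.range d))) =
      generated (Set.range fun k => op (c k) (d k)) := by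
  ext x
  rw [mem_generated_range]
  constructor
  · rintro ⟨_, ⟨f, hf, g, hg, rfl⟩, hx⟩
    obtain ⟨k, hk⟩ := mem_generated_range.1 hf
    obtain ⟨l, hl⟩ := mem_generated_range.1 hg
    exact ⟨max k l, hx.trans (hop (hk.trans (chain_le hc (le_max_left k l)))
      (hl.trans (chain_le hd (le_max_right k l))))⟩
  · rintro ⟨k, hk⟩
    exact ⟨_, ⟨c k, ⟨_, ⟨k, rfl⟩, Le.refl _⟩, d k, ⟨_, ⟨k, rfl⟩, Le.refl _⟩, rfl⟩, hk⟩

theorem comp_ofChain (c : ℕ → FST S n p) (d : ℕ → FST S p q) (hc hd) :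
    (omegaSFST S).comp (ofChain c hc) (ofChain d hd) =
      ofChain (fun k => (c k).comp (d k)) fun k => comp_mono (hc k) (hd k) :=
  Subtype.ext (generated_image2 (op := comp) comp_mono hc hd)

theorem add_ofChain (c d : ℕ → FST S n p) (hc hd) :
    (omegaSFST S).add (ofChain c hc) (ofChain d hd) =
      ofChain (fun k => (c k).add (d k)) fun k => add_mono (hc k) (hd k) :=
  Subtype.ext (generated_image2 (op := add) add_mono hc hd)

theorem principal_comp (f : FST S n p) (g : FST S p q) :
    principal (f.comp g) = (omegaSFST S).comp (principal f) (principal g) := by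
  simp only [principal_eq_ofChain, comp_ofChain]

theorem principal_add (f g : FST S n p) :
    principal (f.add g) = (omegaSFST S).add (principal f) (principal g) := by
  simp only [principal_eq_ofChain, add_ofChain]

theorem principal_ext {f g : FST S n p} (h : f.Le g) (h' : g.Le f) :
    principal f = principal g := by
  simp only [principal_eq_ofChain]
  exact ofChain_ext (fun _ => h) fun _ => h'

theorem id_eq_principal (n : ℕ) : (omegaSFST S).id n = principal (id S n) :=
  rfl

theorem inj_eq_principal (i : Fin n) : (omegaSFST S).inj n i = principal (ex S i) :=
  rfl

theorem zero_eq_principal (n p : ℕ) : (omegaSFST S).zero n p = principal (zero S n p) :=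
  rfl

theorem letterIdeal_eq_principal (σ : S n) : letterIdeal σ = principal (letter σ) :=
  rfl

theorem mem_comp {Q : (omegaSFST S).Hom n p} {Q' : (omegaSFST S).Hom p q} {x : FST S n q} :
    x ∈ ((omegaSFST S).comp Q Q').1 ↔ ∃ f ∈ Q.1, ∃ g ∈ Q'.1, x.Le (f.comp g) := by
  constructor
  · rintro ⟨_, ⟨f, hf, g, hg, rfl⟩, hx⟩
    exact ⟨f, hf, g, hg, hx⟩
  · rintro ⟨f, hf, g, hg, hx⟩
    exact ⟨_, ⟨f, hf, g, hg, rfl⟩, hx⟩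

/-- The order of the theory of `ω`-ideals is inclusion. -/
theorem omegaSFST_le_iff {Q Q' : (omegaSFST S).Hom n p} :
    (omegaSFST S).Le Q Q' ↔ Q.1 ⊆ Q'.1 := by
  constructor
  · intro h f hf
    obtain ⟨g, hg⟩ := Q'.2.1.1
    rw [← show _ = Q' from h]
    exact ⟨_, ⟨f, hf, g, hg, rfl⟩, le_add_left f g⟩
  · intro h
    refine Subtype.ext (Set.Subset.antisymm ?_ fun g hg => ?_)
    · rintro _ ⟨_, ⟨f, hf, g, hg, rfl⟩, hx⟩
      exact mem_of_le hx (add_mem (h hf) hg)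
    · obtain ⟨f, hf⟩ := Q.2.1.1
      exact ⟨_, ⟨f, hf, g, hg, rfl⟩, le_add_right f g⟩

/-- The `i`th component of a tuple of trees. -/
def component (f : FST S n p) (i : Fin n) : FST S 1 p :=
  fun _ => f i

/-- A finite tree as a tuple with a single component. -/
def single {t : SyncTree S p} (ht : t.IsFinite) : FST S 1 p :=
  fun _ => ⟨t, ht⟩

/-- The tuple of trees with the given components. -/
def ofComponents (c : Fin n → FST S 1 p) : FST S n p :=
  fun i => c i 0

theorem component_ofComponents (c : Fin n → FST S 1 p) (i : Fin n) :
    (ofComponents c).component i = c i :=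
  funext fun j => congrArg (c i) (Subsingleton.elim 0 j)

theorem ex_comp_equiv (f : FST S n p) (i : Fin n) :
    ((ex S i).comp f).Le (f.component i) ∧ (f.component i).Le ((ex S i).comp f) :=
  ⟨fun _ => (SyncTree.ex_comp (fun j => (f j).1) i).1,
    fun _ => (SyncTree.ex_comp (fun j => (f j).1) i).2⟩

theorem inj_comp_ofChain (c : ℕ → FST S n p) (hc) (i : Fin n) :
    (omegaSFST S).comp ((omegaSFST S).inj n i) (ofChain c hc) =
      ofChain (fun k => (c k).component i) fun k _ => hc k i := by
  rw [inj_eq_principal, principal_eq_ofChain, comp_ofChain]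
  exact ofChain_ext (fun k => (ex_comp_equiv (c k) i).1) fun k => (ex_comp_equiv (c k) i).2

theorem inj_comp_principal (f : FST S n p) (i : Fin n) :
    (omegaSFST S).comp ((omegaSFST S).inj n i) (principal f) = principal (f.component i) := by
  rw [principal_eq_ofChain, inj_comp_ofChain, principal_eq_ofChain]

/-- A tuple belongs to an ideal generated by a chain if its components belong to the component
ideals, since finitely many elements of the chain have an upper bound in the chain. -/
theorem mem_ofChain_iff_component {c : ℕ → FST S n p} {hc} {f : FST S n p} :
    f ∈ (ofChain c hc).1 ↔
      ∀ i, f.component i ∈ ((omegaSFST S).comp ((omegaSFST S).inj n i) (ofChain c hc)).1 := by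
  simp only [inj_comp_ofChain]
  constructor
  · intro h i
    obtain ⟨k, hk⟩ := mem_generated_range.1 h
    exact mem_generated_range.2 ⟨k, fun _ => hk i⟩
  · intro h
    choose k hk using fun i => mem_generated_range.1 (h i)
    refine mem_generated_range.2 ⟨Finset.univ.sup k, fun i => (hk i 0).trans ?_⟩
    exact chain_le hc (Finset.le_sup (Finset.mem_univ i)) i

theorem omegaSFST_hom_ext {Q Q' : (omegaSFST S).Hom n p}
    (h : ∀ i, (omegaSFST S).comp ((omegaSFST S).inj n i) Q =
      (omegaSFST S).comp ((omegaSFST S).inj n i) Q') : Q = Q' := by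
  obtain ⟨c, hc, rfl⟩ := exists_eq_ofChain Q
  obtain ⟨d, hd, rfl⟩ := exists_eq_ofChain Q'
  exact Subtype.ext (Set.ext fun x => mem_ofChain_iff_component.trans
    (Iff.trans (forall_congr' fun i => by rw [h i]) mem_ofChain_iff_component.symm))

theorem omegaSFST_isTheory (S : ℕ → Type u) : (omegaSFST S).IsTheory where
  assoc Q Q' Q'' := by
    obtain ⟨c, hc, rfl⟩ := exists_eq_ofChain Q
    obtain ⟨d, hd, rfl⟩ := exists_eq_ofChain Q'
    obtain ⟨e, he, rfl⟩ := exists_eq_ofChain Q''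
    simp only [comp_ofChain]
    have h k i := SyncTree.comp_assoc (c k i).1 (fun j => (d k j).1) fun j => (e k j).1
    exact ofChain_ext (fun k i => (h k i).1) fun k i => (h k i).2
  id_comp Q := by
    obtain ⟨c, hc, rfl⟩ := exists_eq_ofChain Q
    rw [id_eq_principal, principal_eq_ofChain, comp_ofChain]
    exact ofChain_ext (fun k i => (SyncTree.ex_comp (fun j => (c k j).1) i).1)
      fun k i => (SyncTree.ex_comp (fun j => (c k j).1) i).2
  comp_id Q := by
    obtain ⟨c, hc, rfl⟩ := exists_eq_ofChain Q
    rw [id_eq_principal, principal_eq_ofChain, comp_ofChain]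
    exact ofChain_ext (fun k i => (SyncTree.comp_ex _).1) fun k i => (SyncTree.comp_ex _).2
  tupling f := by
    choose c hc h using fun i => exists_eq_ofChain (f i)
    refine ⟨ofChain (fun k => ofComponents fun i => c i k) fun k i => hc i k 0,
      fun i => ?_, fun Q hQ => ?_⟩
    · refine (inj_comp_ofChain _ _ i).trans (Eq.trans ?_ (h i).symm)
      simp only [component_ofComponents]
    · obtain ⟨d, hd, rfl⟩ := exists_eq_ofChain Q
      refine omegaSFST_hom_ext fun i => ((hQ i).trans (h i)).trans
        (Eq.trans ?_ (inj_comp_ofChain _ _ i).symm)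
      simp only [component_ofComponents]
  inj_one := by
    rw [inj_eq_principal, id_eq_principal]
    congr 1
    funext i
    rw [Subsingleton.elim i 0]
    rfl

theorem omegaSFST_isIdempotentGroveTheory (S : ℕ → Type u) :
    (omegaSFST S).IsIdempotentGroveTheory where
  toIsTheory := omegaSFST_isTheory S
  add_assoc Q Q' Q'' := by
    obtain ⟨c, hc, rfl⟩ := exists_eq_ofChain Q
    obtain ⟨d, hd, rfl⟩ := exists_eq_ofChain Q'
    obtain ⟨e, he, rfl⟩ := exists_eq_ofChain Q''
    simp only [add_ofChain]
    exact ofChain_ext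
      (fun k => add_le (add_le (le_add_left _ _) ((le_add_left _ _).trans (le_add_right _ _)))
        ((le_add_right _ _).trans (le_add_right _ _)))
      fun k => add_le ((le_add_left _ _).trans (le_add_left _ _))
        (add_le ((le_add_right _ _).trans (le_add_left _ _)) (le_add_right _ _))
  add_comm Q Q' := by
    obtain ⟨c, hc, rfl⟩ := exists_eq_ofChain Q
    obtain ⟨d, hd, rfl⟩ := exists_eq_ofChain Q'
    simp only [add_ofChain]
    exact ofChain_ext (fun k => add_le (le_add_right _ _) (le_add_left _ _))
      fun k => add_le (le_add_right _ _) (le_add_left _ _)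
  add_zero Q := by
    obtain ⟨c, hc, rfl⟩ := exists_eq_ofChain Q
    rw [zero_eq_principal, principal_eq_ofChain, add_ofChain]
    exact ofChain_ext (fun k => add_le (Le.refl _) fun i => SyncTree.zero_le _)
      fun k => le_add_left _ _
  inj_add i Q Q' := by
    obtain ⟨c, hc, rfl⟩ := exists_eq_ofChain Q
    obtain ⟨d, hd, rfl⟩ := exists_eq_ofChain Q'
    simp only [add_ofChain, inj_comp_ofChain]
    exact (add_ofChain _ _ _ _).symm
  inj_zero p i := by
    simp only [zero_eq_principal, principal_eq_ofChain, inj_comp_ofChain]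
    rfl
  add_comp Q Q' Q'' := by
    obtain ⟨c, hc, rfl⟩ := exists_eq_ofChain Q
    obtain ⟨d, hd, rfl⟩ := exists_eq_ofChain Q'
    obtain ⟨e, he, rfl⟩ := exists_eq_ofChain Q''
    simp only [add_ofChain, comp_ofChain]
    have h k i := SyncTree.add_comp (c k i).1 (d k i).1 fun j => (e k j).1
    exact ofChain_ext (fun k i => (h k i).1) fun k i => (h k i).2
  zero_comp n Q := by
    obtain ⟨c, hc, rfl⟩ := exists_eq_ofChain Q
    simp only [zero_eq_principal, principal_eq_ofChain, comp_ofChain]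
    exact ofChain_ext (fun k i => (SyncTree.zero_comp _).1) fun k i => (SyncTree.zero_comp _).2
  add_self Q := omegaSFST_le_iff.2 (Set.Subset.refl _)

/-- The union of an `ω`-chain of `ω`-ideals is an `ω`-ideal: if the `k`th ideal is generated by
`c_k0 ⊑ c_k1 ⊑ ⋯`, the union is generated by the trees `c_0k + ⋯ + c_kk`. -/
theorem isOmegaIdeal_iUnion {Q : ℕ → (omegaSFST S).Hom n p} (hQ : (omegaSFST S).IsChain Q) :
    IsOmegaIdeal (⋃ k, (Q k).1) := by
  have hmono : Monotone fun k => (Q k).1 :=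
    monotone_nat_of_le_succ fun k => omegaSFST_le_iff.1 (hQ k)
  choose c hc h using fun k => exists_eq_ofChain (Q k)
  let s : ℕ → ℕ → FST S n p := fun l k => Nat.rec (c 0 k) (fun j x => x.add (c (j + 1) k)) l
  have hs : ∀ l k, (s l k).Le (s l (k + 1)) := by
    intro l k
    induction l with
    | zero => exact hc 0 k
    | succ l ih => exact add_mono ih (hc (l + 1) k)
  have hcs : ∀ {j l} k, j ≤ l → (c j k).Le (s l k) := by
    intro j l k hjl
    induction hjl with
    | refl => cases j with
      | zero => exact Le.refl _
      | succ j => exact le_add_right _ _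
    | step _ ih => exact ih.trans (le_add_left _ _)
  have hcQ : ∀ j k, c j k ∈ (Q j).1 := fun j k => by
    rw [h]
    exact mem_generated_range.2 ⟨k, Le.refl _⟩
  have hsQ : ∀ l k, s l k ∈ (Q l).1 := by
    intro l k
    induction l with
    | zero => exact hcQ 0 k
    | succ l ih => exact add_mem (hmono (Nat.le_succ l) ih) (hcQ (l + 1) k)
  have hd : ∀ k, (s k k).Le (s (k + 1) (k + 1)) := fun k =>
    (hs k k).trans (le_add_left _ _)
  have heq : ⋃ k, (Q k).1 = generated (Set.range fun k => s k k) := by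
    ext f
    rw [Set.mem_iUnion, mem_generated_range]
    constructor
    · rintro ⟨j, hj⟩
      rw [h] at hj
      obtain ⟨k, hk⟩ := mem_generated_range.1 hj
      exact ⟨max j k, hk.trans ((chain_le (hc j) (le_max_right j k)).trans
        (hcs _ (le_max_left j k)))⟩
    · rintro ⟨k, hk⟩
      exact ⟨k, mem_of_le hk (hsQ k k)⟩
  rw [heq]
  exact isOmegaIdeal_generated hd

theorem isSup_of_eq_iUnion {Q : ℕ → (omegaSFST S).Hom n p} {R : (omegaSFST S).Hom n p}
    (h : R.1 = ⋃ k, (Q k).1) : (omegaSFST S).IsSup Q R := by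
  constructor
  · intro k
    rw [omegaSFST_le_iff, h]
    exact Set.subset_iUnion (fun k => (Q k).1) k
  · intro b hb
    rw [omegaSFST_le_iff, h]
    exact Set.iUnion_subset fun k => omegaSFST_le_iff.1 (hb k)

/-- The supremum of a chain of `ω`-ideals is its union. -/
theorem isSup_iff_eq_iUnion {Q : ℕ → (omegaSFST S).Hom n p} (hQ : (omegaSFST S).IsChain Q)
    {R : (omegaSFST S).Hom n p} : (omegaSFST S).IsSup Q R ↔ R.1 = ⋃ k, (Q k).1 := by
  refine ⟨fun h => ?_, isSup_of_eq_iUnion⟩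
  refine Set.Subset.antisymm ?_ (Set.iUnion_subset fun k => omegaSFST_le_iff.1 (h.1 k))
  exact omegaSFST_le_iff.1 (h.2 ⟨_, isOmegaIdeal_iUnion hQ⟩
    fun k => omegaSFST_le_iff.2 (Set.subset_iUnion (fun k => (Q k).1) k))

theorem isSup_principal (c : ℕ → FST S n p) (hc) :
    (omegaSFST S).IsSup (fun k => principal (c k)) (ofChain c hc) :=
  isSup_of_eq_iUnion (Set.ext fun f => by
    simp only [ofChain, principal, mem_generated_range, Set.mem_iUnion, mem_principal])

theorem isChain_principal {c : ℕ → FST S n p} (hc : ∀ k, (c k).Le (c (k + 1))) :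
    (omegaSFST S).IsChain fun k => principal (c k) :=
  fun k => omegaSFST_le_iff.2 fun _ hf => mem_principal.2 ((mem_principal.1 hf).trans (hc k))

theorem omegaSFST_isOmegaContinuous (S : ℕ → Type u) :
    (omegaSFST S).IsOmegaContinuousIdempotentGroveTheory where
  toIsIdempotentGroveTheory := omegaSFST_isIdempotentGroveTheory S
  exists_sup Q hQ := ⟨⟨_, isOmegaIdeal_iUnion hQ⟩, isSup_of_eq_iUnion rfl⟩
  sup_comp Q R Q' hQ hR := by
    rw [isSup_iff_eq_iUnion hQ] at hR
    refine isSup_of_eq_iUnion (Set.ext fun x => ?_)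
    simp only [Set.mem_iUnion, mem_comp, hR]
    exact ⟨fun ⟨f, ⟨k, hf⟩, h⟩ => ⟨k, f, hf, h⟩, fun ⟨k, f, hf, h⟩ => ⟨f, ⟨k, hf⟩, h⟩⟩
  comp_sup Q' Q R hQ hR := by
    rw [isSup_iff_eq_iUnion hQ] at hR
    refine isSup_of_eq_iUnion (Set.ext fun x => ?_)
    simp only [Set.mem_iUnion, mem_comp, hR]
    exact ⟨fun ⟨f, hf, g, ⟨k, hg⟩, h⟩ => ⟨k, f, hf, g, hg, h⟩,
      fun ⟨k, f, hf, g, hg, h⟩ => ⟨f, hf, g, ⟨k, hg⟩, h⟩⟩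

theorem letterIdeal_injective (n : ℕ) : Function.Injective fun σ : S n => letterIdeal σ := by
  intro σ τ h
  have h1 : letter σ ∈ (letterIdeal σ).1 := mem_principal.2 (Le.refl _)
  rw [show letterIdeal σ = letterIdeal τ from h] at h1
  exact SyncTree.letter_le (mem_principal.1 h1 0)

end FST

open HyperGraph TheoryData

/-! ### Evaluation of finite trees -/

section eval

variable {S : ℕ → Type u} {T : TheoryData.{v}} {n p q : ℕ}

/-- `ev` evaluates the vertices of `G` in `T`, with the letters interpreted by `φ`: the value at
`v` is the least upper bound of the values of the edges with source `v`, where an edge labelled `σ`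
has the value `φ(σ) · ⟨x_1, …, x_n⟩` with `x_i` the value at its `i`th target, and an exit edge
labelled `ex_i` has the value `i_p`. -/
def IsEval (hT : T.IsTheory) (φ : (n : ℕ) → S n → T.Hom 1 n) (G : HyperGraph S p)
    (ev : G.V → T.Hom 1 p) : Prop :=
  ∀ v b, T.Le (ev v) b ↔
    (∀ (n : ℕ) (σ : S n) (e : G.E n σ), G.src e = v →
      T.Le (T.comp (φ n σ) (tuple hT fun i => ev (G.tgt e i))) b) ∧
    ∀ (i : Fin p) (e : G.X i), G.exitSrc e = v → T.Le (T.inj p i) b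

variable (hT : T.IsOmegaContinuousIdempotentGroveTheory) {φ : (n : ℕ) → S n → T.Hom 1 n}

include hT

/-- A finite tree can be evaluated, by recursion from the leaves to the root. -/
theorem exists_isEval (φ : (n : ℕ) → S n → T.Hom 1 n) {t : SyncTree S p} (ht : t.IsFinite) :
    ∃ ev, IsEval hT.toIsTheory φ t.toHyperGraph ev := by
  have hT' := hT.toIsIdempotentGroveTheory
  have step : ∀ (v : t.V) (ih : ∀ u, SyncTree.Child t.toHyperGraph u v → T.Hom 1 p),
      ∃ x, ∀ b, T.Le x b ↔
        (∀ (n : ℕ) (σ : S n) (e : t.E n σ) (h : t.src e = v), T.Le (T.comp (φ n σ)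
          (tuple hT.toIsTheory fun i => ih (t.tgt e i) ⟨n, σ, e, i, h, rfl⟩)) b) ∧
        ∀ (i : Fin p) (e : t.X i), t.exitSrc e = v → T.Le (T.inj p i) b := by
    classical
    intro v ih
    have : Finite t.toHyperGraph.Edge := ht
    obtain ⟨x, hx⟩ := hT'.exists_bound (ι := t.toHyperGraph.Edge) (n := 1) (p := p)
      fun a => match a with
      | .inl ⟨n, σ, e⟩ => if h : t.src e = v then T.comp (φ n σ)
          (tuple hT.toIsTheory fun i => ih (t.tgt e i) ⟨n, σ, e, i, h, rfl⟩) else T.zero 1 p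
      | .inr ⟨i, e⟩ => if t.exitSrc e = v then T.inj p i else T.zero 1 p
    refine ⟨x, fun b => (hx b).trans ⟨fun H => ⟨fun n σ e h => ?_, fun i e h => ?_⟩, ?_⟩⟩
    · simpa only [dif_pos h] using H (.inl ⟨n, σ, e⟩)
    · simpa only [if_pos h] using H (.inr ⟨i, e⟩)
    · rintro ⟨h1, h2⟩ (⟨n, σ, e⟩ | ⟨i, e⟩) <;> dsimp only <;> split_ifs with h
      exacts [h1 n σ e h, hT'.zero_le b, h2 i e h, hT'.zero_le b]
  choose F hF using step
  refine ⟨(SyncTree.wellFounded_child ht).fix F, fun v b => ?_⟩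
  rw [WellFounded.fix_eq]
  exact hF v _ b

theorem IsEval.edge_le {G : HyperGraph S p} {ev : G.V → T.Hom 1 p}
    (h : IsEval hT.toIsTheory φ G ev) {n : ℕ} {σ : S n} (e : G.E n σ) :
    T.Le (T.comp (φ n σ) (tuple hT.toIsTheory fun i => ev (G.tgt e i))) (ev (G.src e)) :=
  ((h _ _).1 (hT.toIsIdempotentGroveTheory.le_refl _)).1 n σ e rfl

theorem IsEval.exit_le {G : HyperGraph S p} {ev : G.V → T.Hom 1 p}
    (h : IsEval hT.toIsTheory φ G ev) {i : Fin p} (e : G.X i) :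
    T.Le (T.inj p i) (ev (G.exitSrc e)) :=
  ((h _ _).1 (hT.toIsIdempotentGroveTheory.le_refl _)).2 i e rfl

theorem comp_tuple_mono (g : T.Hom 1 n) {f f' : Fin n → T.Hom 1 p} (h : ∀ i, T.Le (f i) (f' i)) :
    T.Le (T.comp g (tuple hT.toIsTheory f)) (T.comp g (tuple hT.toIsTheory f')) :=
  comp_mono_right hT g (tuple_mono hT.toIsIdempotentGroveTheory h)

/-- Evaluation is monotone for simulations, which makes the value of a tree independent of its
presentation. -/
theorem IsEval.mono {G H : HyperGraph S p} (hG : WellFounded (SyncTree.Child G))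
    {ev : G.V → T.Hom 1 p} {ev' : H.V → T.Hom 1 p} (h : IsEval hT.toIsTheory φ G ev)
    (h' : IsEval hT.toIsTheory φ H ev') {v : G.V} {w : H.V} (hvw : G.Sim v H w) :
    T.Le (ev v) (ev' w) := by
  induction v using hG.induction generalizing w with
  | _ v ih =>
  refine (h v _).2 ⟨?_, ?_⟩
  · rintro n σ e rfl
    obtain ⟨d, rfl, hd⟩ := hvw.edge e
    exact hT.toIsIdempotentGroveTheory.le_trans
      (comp_tuple_mono hT _ fun i => ih _ ⟨n, σ, e, i, rfl, rfl⟩ (hd i)) (h'.edge_le hT d)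
  · rintro i e rfl
    obtain ⟨d, rfl⟩ := hvw.exit e
    exact h'.exit_le hT d

/-- The values of the vertices of a finite tree. -/
noncomputable def evalVertex (φ : (n : ℕ) → S n → T.Hom 1 n) {t : SyncTree S p}
    (ht : t.IsFinite) : t.V → T.Hom 1 p :=
  (exists_isEval hT φ ht).choose

theorem isEval_evalVertex {t : SyncTree S p} (ht : t.IsFinite) :
    IsEval hT.toIsTheory φ t.toHyperGraph (evalVertex hT φ ht) :=
  (exists_isEval hT φ ht).choose_spec

/-- The value of a finite tree: the value of its root. -/
noncomputable def eval (φ : (n : ℕ) → S n → T.Hom 1 n) {t : SyncTree S p} (ht : t.IsFinite) :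
    T.Hom 1 p :=
  evalVertex hT φ ht t.root

theorem evalVertex_mono {t t' : SyncTree S p} (ht : t.IsFinite) (ht' : t'.IsFinite) {v : t.V}
    {w : t'.V} (h : t.toHyperGraph.Sim v t'.toHyperGraph w) :
    T.Le (evalVertex hT φ ht v) (evalVertex hT φ ht' w) :=
  (isEval_evalVertex hT ht).mono hT (SyncTree.wellFounded_child ht) (isEval_evalVertex hT ht') h

theorem eval_mono {t t' : SyncTree S p} (ht : t.IsFinite) (ht' : t'.IsFinite) (h : t.Le t') :
    T.Le (eval hT φ ht) (eval hT φ ht') :=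
  evalVertex_mono hT ht ht' (SyncTree.le_iff_sim.1 h)

theorem eval_congr {t t' : SyncTree S p} (ht : t.IsFinite) (ht' : t'.IsFinite)
    (h : t.Equiv t') : eval hT φ ht = eval hT φ ht' :=
  hT.toIsIdempotentGroveTheory.le_antisymm (eval_mono hT ht ht' h.1) (eval_mono hT ht' ht h.2)

theorem eval_zero (h : (SyncTree.zero S p).IsFinite) : eval hT φ h = T.zero 1 p :=
  hT.toIsIdempotentGroveTheory.le_antisymm
    ((isEval_evalVertex hT h _ _).2 ⟨fun _ _ e => Empty.elim e, fun _ e => Empty.elim e⟩)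
    (hT.toIsIdempotentGroveTheory.zero_le _)

theorem eval_ex (i : Fin p) (h : (SyncTree.ex S i).IsFinite) : eval hT φ h = T.inj p i := by
  refine hT.toIsIdempotentGroveTheory.le_antisymm
    ((isEval_evalVertex hT h _ _).2 ⟨fun _ _ e => Empty.elim e, ?_⟩)
    ((isEval_evalVertex hT h).exit_le hT (i := i) (PLift.up rfl))
  rintro _ ⟨rfl⟩ -
  exact hT.toIsIdempotentGroveTheory.le_refl _

theorem eval_add {t s : SyncTree S p} (ht : t.IsFinite) (hs : s.IsFinite)
    (h : (t.add s).IsFinite) : eval hT φ h = T.add (eval hT φ ht) (eval hT φ hs) := by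
  have hT' := hT.toIsIdempotentGroveTheory
  refine hT'.le_antisymm ((isEval_evalVertex hT h _ _).2 ⟨fun n σ e he => ?_, fun i e he => ?_⟩)
    (hT'.add_le_iff.2 ⟨eval_mono hT ht h (SyncTree.le_add_left t s),
      eval_mono hT hs h (SyncTree.le_add_right t s)⟩)
  · obtain ⟨d, hd, h'⟩ | ⟨d, hd, h'⟩ := SyncTree.add_edge e he
    · refine hT'.le_trans (hT'.le_trans
        (comp_tuple_mono hT _ fun i => evalVertex_mono hT h ht (h' i))
        ((isEval_evalVertex hT ht).edge_le hT d)) ?_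
      rw [hd]
      exact hT'.le_add_left _ _
    · refine hT'.le_trans (hT'.le_trans
        (comp_tuple_mono hT _ fun i => evalVertex_mono hT h hs (h' i))
        ((isEval_evalVertex hT hs).edge_le hT d)) ?_
      rw [hd]
      exact hT'.le_add_right _ _
  · obtain ⟨d, hd⟩ | ⟨d, hd⟩ := SyncTree.add_exit e he
    · refine hT'.le_trans ((isEval_evalVertex hT (φ := φ) ht).exit_le hT d) ?_
      rw [hd]
      exact hT'.le_add_left _ _
    · refine hT'.le_trans ((isEval_evalVertex hT (φ := φ) hs).exit_le hT d) ?_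
      rw [hd]
      exact hT'.le_add_right _ _

theorem eval_letter_comp {n : ℕ} (σ : S n) {s : Fin n → SyncTree S p} (hs : ∀ i, (s i).IsFinite)
    (h : ((SyncTree.letter σ).comp s).IsFinite) :
    eval hT φ h = T.comp (φ n σ) (tuple hT.toIsTheory fun i => eval hT φ (hs i)) := by
  have hT' := hT.toIsIdempotentGroveTheory
  refine hT'.le_antisymm ((isEval_evalVertex hT h _ _).2 ⟨fun m τ e he => ?_, fun i e he => ?_⟩) ?_
  · cases SyncTree.letter_comp_edge e he
    exact comp_tuple_mono hT _ fun i =>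
      evalVertex_mono hT h (hs i) (SyncTree.letter_tgt_sim σ s i)
  · exact absurd he (SyncTree.letter_comp_exit e)
  · exact hT'.le_trans (comp_tuple_mono hT _ fun i =>
      evalVertex_mono hT (hs i) h (SyncTree.sim_letter_tgt σ s i))
      ((isEval_evalVertex hT h).edge_le hT (SyncTree.compEdge (SyncTree.letter σ) s .edge))

/-- Evaluation preserves composition. By induction on `t`, this reduces to the laws that both sides
have in common. -/
theorem eval_comp {t : SyncTree S p} {s : Fin p → SyncTree S q} (ht : t.IsFinite)
    (hs : ∀ i, (s i).IsFinite) (h : (t.comp s).IsFinite) :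
    eval hT φ h = T.comp (eval hT φ ht) (tuple hT.toIsTheory fun i => eval hT φ (hs i)) := by
  suffices H : ∀ (ht : t.IsFinite) (h : (t.comp s).IsFinite), eval hT φ h =
      T.comp (eval hT φ ht) (tuple hT.toIsTheory fun i => eval hT φ (hs i)) from H ht h
  refine SyncTree.finite_induction (P := fun t => ∀ (ht : t.IsFinite) (h : (t.comp s).IsFinite),
      eval hT φ h = T.comp (eval hT φ ht) (tuple hT.toIsTheory fun i => eval hT φ (hs i)))
    ?_ ?_ ?_ ?_ ?_ ht
  · intro t t' ht ht' he ih _ h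
    rw [eval_congr hT ht' ht he.symm, ← ih ht (SyncTree.comp_isFinite ht hs)]
    exact eval_congr hT _ _
      ⟨SyncTree.comp_mono he.2 fun _ => .refl _, SyncTree.comp_mono he.1 fun _ => .refl _⟩
  · intro ht h
    rw [eval_zero, hT.zero_comp, ← eval_zero hT (SyncTree.zero_isFinite S q)]
    exact eval_congr hT _ _ (SyncTree.zero_comp s)
  · intro i ht h
    rw [eval_ex, inj_tuple]
    exact eval_congr hT _ _ (SyncTree.ex_comp s i)
  · intro t t' ht ht' ih ih' h1 h
    have h2 := SyncTree.comp_isFinite ht hs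
    have h3 := SyncTree.comp_isFinite ht' hs
    rw [eval_add hT ht ht', hT.add_comp, ← ih ht h2, ← ih' ht' h3,
      ← eval_add hT h2 h3 (SyncTree.add_isFinite h2 h3)]
    exact eval_congr hT _ _ (SyncTree.add_comp t t' s)
  · intro n σ r hr ih h1 h
    have h2 := fun i => SyncTree.comp_isFinite (hr i) hs
    rw [eval_letter_comp hT σ hr, hT.assoc, tuple_comp]
    simp only [← ih _ (hr _) (h2 _)]
    rw [← eval_letter_comp hT σ h2 (SyncTree.comp_isFinite (SyncTree.letter_isFinite σ) h2)]
    exact eval_congr hT _ _ (SyncTree.comp_assoc _ _ _)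

/-- The value of a tuple of finite trees. -/
noncomputable def evalTuple (φ : (n : ℕ) → S n → T.Hom 1 n) (f : FST S n p) : T.Hom n p :=
  tuple hT.toIsTheory fun i => eval hT φ (f i).2

theorem evalTuple_mono {f g : FST S n p} (h : f.Le g) :
    T.Le (evalTuple hT φ f) (evalTuple hT φ g) :=
  tuple_mono hT.toIsIdempotentGroveTheory fun i => eval_mono hT _ _ (h i)

theorem evalTuple_one (f : FST S 1 p) : evalTuple hT φ f = eval hT φ (f 0).2 := by
  rw [evalTuple, ← hT.id_comp (tuple _ _), ← hT.inj_one, inj_tuple]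

theorem evalTuple_id : evalTuple hT φ (FST.id S n) = T.id n := by
  rw [← tuple_inj hT.toIsTheory]
  exact congrArg _ (funext fun i => eval_ex hT i _)

theorem evalTuple_comp (f : FST S n p) (g : FST S p q) :
    evalTuple hT φ (f.comp g) = T.comp (evalTuple hT φ f) (evalTuple hT φ g) := by
  unfold evalTuple
  rw [tuple_comp]
  exact congrArg _ (funext fun i => eval_comp hT (f i).2 (fun j => (g j).2) _)

theorem evalTuple_add (f g : FST S n p) :
    evalTuple hT φ (f.add g) = T.add (evalTuple hT φ f) (evalTuple hT φ g) := by
  refine hT.hom_ext fun i => ?_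
  rw [hT.inj_add]
  simp only [evalTuple, inj_tuple]
  exact eval_add hT (f i).2 (g i).2 _

theorem evalTuple_zero : evalTuple hT φ (FST.zero S n p) = T.zero n p := by
  refine hT.hom_ext fun i => ?_
  rw [hT.inj_zero, evalTuple, inj_tuple]
  exact eval_zero hT _

/-- The tree of a letter `σ` is equivalent to `σ · (ex_1, …, ex_n)`, so its value is `φ(σ)`. -/
theorem evalTuple_letter (σ : S n) : evalTuple hT φ (FST.letter σ) = φ n σ := by
  have h := SyncTree.comp_isFinite (SyncTree.letter_isFinite σ) (SyncTree.ex_isFinite S)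
  rw [evalTuple_one, eval_congr hT (FST.letter σ 0).2 h (SyncTree.comp_ex _).symm,
    eval_letter_comp hT σ (SyncTree.ex_isFinite S)]
  simp only [eval_ex]
  rw [tuple_inj, hT.comp_id]

/-! ### The extension to `ω`-ideals -/

theorem exists_extend (φ : (n : ℕ) → S n → T.Hom 1 n) (Q : (omegaSFST S).Hom n p) :
    ∃ x, ∀ b, T.Le x b ↔ ∀ f ∈ Q.1, T.Le (evalTuple hT φ f) b := by
  have hT' := hT.toIsIdempotentGroveTheory
  obtain ⟨c, hc, rfl⟩ := FST.exists_eq_ofChain Q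
  obtain ⟨x, hx⟩ := hT.exists_sup (fun k => evalTuple hT φ (c k)) fun k => evalTuple_mono hT (hc k)
  refine ⟨x, fun b => ((hT'.isSup_iff.1 hx) b).trans ⟨fun h f hf => ?_, fun h k => ?_⟩⟩
  · obtain ⟨k, hk⟩ := FST.mem_generated_range.1 hf
    exact hT'.le_trans (evalTuple_mono hT hk) (h k)
  · exact h _ (FST.mem_generated_range.2 ⟨k, .refl _⟩)

/-- The value of an `ω`-ideal: the least upper bound of the values of its elements. -/
noncomputable def extend (φ : (n : ℕ) → S n → T.Hom 1 n) (Q : (omegaSFST S).Hom n p) :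
    T.Hom n p :=
  (exists_extend hT φ Q).choose

theorem extend_le_iff {Q : (omegaSFST S).Hom n p} {b : T.Hom n p} :
    T.Le (extend hT φ Q) b ↔ ∀ f ∈ Q.1, T.Le (evalTuple hT φ f) b :=
  (exists_extend hT φ Q).choose_spec b

theorem isSup_extend_ofChain (c : ℕ → FST S n p) (hc) :
    T.IsSup (fun k => evalTuple hT φ (c k)) (extend hT φ (FST.ofChain c hc)) := by
  have hT' := hT.toIsIdempotentGroveTheory
  refine hT'.isSup_iff.2 fun b => (extend_le_iff hT).trans ⟨fun h k => ?_, fun h f hf => ?_⟩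
  · exact h _ (FST.mem_generated_range.2 ⟨k, .refl _⟩)
  · obtain ⟨k, hk⟩ := FST.mem_generated_range.1 hf
    exact hT'.le_trans (evalTuple_mono hT hk) (h k)

theorem isSup_unique {f : ℕ → T.Hom n p} {s s' : T.Hom n p} (h : T.IsSup f s)
    (h' : T.IsSup f s') : s = s' :=
  hT.toIsIdempotentGroveTheory.le_antisymm (h.2 _ h'.1) (h'.2 _ h.1)

theorem extend_principal (f : FST S n p) : extend hT φ (FST.principal f) = evalTuple hT φ f :=
  hT.toIsIdempotentGroveTheory.eq_of_le_iff fun _ => (extend_le_iff hT).trans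
    ⟨fun h => h f (FST.mem_principal.2 (.refl f)), fun h _ hg =>
      hT.toIsIdempotentGroveTheory.le_trans (evalTuple_mono hT (FST.mem_principal.1 hg)) h⟩

/-- The morphism out of the theory of `ω`-ideals that extends `φ`. -/
noncomputable def extendMorphism (φ : (n : ℕ) → S n → T.Hom 1 n) :
    OmegaMorphism (omegaSFST S) T where
  map := extend hT φ
  map_id n := (extend_principal hT _).trans (evalTuple_id hT)
  map_comp Q Q' := by
    obtain ⟨c, hc, rfl⟩ := FST.exists_eq_ofChain Q
    obtain ⟨d, hd, rfl⟩ := FST.exists_eq_ofChain Q'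
    rw [FST.comp_ofChain]
    have h := isSup_extend_ofChain hT (φ := φ) (fun k => (c k).comp (d k))
      fun k => FST.comp_mono (hc k) (hd k)
    simp only [evalTuple_comp] at h
    exact isSup_unique hT h (isSup_comp hT (fun k => evalTuple_mono hT (hc k))
      (fun k => evalTuple_mono hT (hd k)) (isSup_extend_ofChain hT c hc)
      (isSup_extend_ofChain hT d hd))
  map_inj n i := (extend_principal hT _).trans
    ((evalTuple_one hT _).trans (eval_ex hT i (SyncTree.ex_isFinite S i)))
  map_add Q Q' := by
    have hT' := hT.toIsIdempotentGroveTheory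
    refine hT'.eq_of_le_iff fun b => ?_
    rw [hT'.add_le_iff, extend_le_iff, extend_le_iff, extend_le_iff]
    constructor
    · intro h
      have h' : ∀ f ∈ Q.1, ∀ g ∈ Q'.1, T.Le (evalTuple hT φ f) b ∧ T.Le (evalTuple hT φ g) b := by
        intro f hf g hg
        rw [← hT'.add_le_iff, ← evalTuple_add]
        exact h _ ⟨_, ⟨f, hf, g, hg, rfl⟩, .refl _⟩
      obtain ⟨f₀, hf₀⟩ := Q.2.1.1
      obtain ⟨g₀, hg₀⟩ := Q'.2.1.1
      exact ⟨fun f hf => (h' f hf g₀ hg₀).1, fun g hg => (h' f₀ hf₀ g hg).2⟩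
    · rintro ⟨h, h'⟩ x ⟨_, ⟨f, hf, g, hg, rfl⟩, hx⟩
      refine hT'.le_trans (evalTuple_mono hT hx) ?_
      rw [evalTuple_add, hT'.add_le_iff]
      exact ⟨h f hf, h' g hg⟩
  map_zero n p := (extend_principal hT _).trans (evalTuple_zero hT)
  map_sup Q R hQ hR := by
    refine hT.toIsIdempotentGroveTheory.isSup_iff.2 fun b => ?_
    simp only [extend_le_iff, (FST.isSup_iff_eq_iUnion hQ).1 hR, Set.mem_iUnion]
    exact ⟨fun h k f hf => h f ⟨k, hf⟩, fun h f ⟨k, hf⟩ => h k f hf⟩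

/-- A morphism that extends `φ` is determined on principal ideals by induction on finite trees,
and on all `ω`-ideals by continuity. -/
theorem map_eq_extend (h : OmegaMorphism (omegaSFST S) T)
    (hφ : ∀ (n : ℕ) (σ : S n), h.map (letterIdeal σ) = φ n σ) (Q : (omegaSFST S).Hom n p) :
    h.map Q = extend hT φ Q := by
  have tup : ∀ {m q : ℕ} (f : FST S m q),
      (∀ i, h.map (FST.principal (f.component i)) = eval hT φ (f i).2) →
      h.map (FST.principal f) = evalTuple hT φ f := by
    intro m q f hf
    refine hT.hom_ext fun i => ?_
    rw [← h.map_inj, ← h.map_comp, FST.inj_comp_principal, hf, h.map_inj, evalTuple, inj_tuple]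
  have tree : ∀ {q : ℕ} {t : SyncTree S q} (ht : t.IsFinite),
      h.map (FST.principal (FST.single ht)) = eval hT φ ht := by
    intro q t ht
    suffices H : ∀ ht : t.IsFinite,
      h.map (FST.principal (FST.single ht)) = eval hT φ ht from H ht
    refine SyncTree.finite_induction (P := fun t => ∀ ht : t.IsFinite,
      h.map (FST.principal (FST.single ht)) = eval hT φ ht) ?_ ?_ ?_ ?_ ?_ ht
    · intro t t' ht ht' he ih _
      rw [eval_congr hT ht' ht he.symm, ← ih ht]
      exact congrArg _ (FST.principal_ext (fun _ => he.2) fun _ => he.1)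
    · intro ht
      rw [eval_zero]
      exact h.map_zero 1 q
    · intro i ht
      rw [eval_ex]
      exact h.map_inj q i
    · intro t s ht hs iht ihs h1
      rw [eval_add hT ht hs, ← iht ht, ← ihs hs, ← h.map_add]
      exact congrArg _ (FST.principal_add (FST.single ht) (FST.single hs))
    · intro m σ s hs ih h1
      rw [eval_letter_comp hT σ hs, ← hφ]
      have := tup (fun i => ⟨s i, hs i⟩) fun i => ih i (hs i)
      unfold evalTuple at this
      rw [← this, FST.letterIdeal_eq_principal, ← h.map_comp]
      exact congrArg _ (FST.principal_comp (FST.letter σ) fun i => ⟨s i, hs i⟩)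
  obtain ⟨c, hc, rfl⟩ := FST.exists_eq_ofChain Q
  have h1 := h.map_sup _ _ (FST.isChain_principal hc) (FST.isSup_principal c hc)
  simp only [tup _ fun i => tree _] at h1
  exact isSup_unique hT h1 (isSup_extend_ofChain hT c hc)

end eval

end Grove

/-- For each ranked alphabet `S`, the `ω`-ideals of finite synchronization trees over `S` form an
`ω`-continuous idempotent grove theory, which is freely generated by `S`. -/
theorem mainTheorem2 (S : ℕ → Type u) :
    (Grove.omegaSFST S).IsOmegaContinuousIdempotentGroveTheory ∧
    (∀ n : ℕ, Function.Injective (fun σ : S n => Grove.letterIdeal σ)) ∧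
    ∀ T : Grove.TheoryData.{v}, T.IsOmegaContinuousIdempotentGroveTheory →
      ∀ φ : (n : ℕ) → S n → T.Hom 1 n,
        ∃! h : Grove.TheoryData.OmegaMorphism (Grove.omegaSFST S) T,
          ∀ (n : ℕ) (σ : S n), h.map (Grove.letterIdeal σ) = φ n σ := by
  refine ⟨Grove.FST.omegaSFST_isOmegaContinuous S, Grove.FST.letterIdeal_injective,
    fun T hT φ => ⟨Grove.extendMorphism hT φ, fun n σ => ?_, fun h hφ => ?_⟩⟩
  · exact (Grove.extend_principal hT _).trans (Grove.evalTuple_letter hT σ)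
  · ext n p Q
    exact Grove.map_eq_extend hT h hφ Q
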